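/- Let $r\ge 1$. For $\mathbf s=(s_1,\dots,s_r)\in\mathbb C^r$ and $\mathbf z=(z_1,\dots,z_r)\in\mathbb C^r$ with $|z_j|<1$, the multiple polylogarithm is $$\mathrm{Li}_{\mathbf s}(\mathbf z)=\sum_{0<n_1<\cdots<n_r}\frac{z_1^{n_1}z_2^{n_2-n_1}\cdots z_r^{n_r-n_{r-1}}}{n_1^{s_1}\cdots n_r^{s_r}} .$$ The series converges absolutely, and $\mathrm{Li}_{\mathbf s}(\mathbf z)$ has a holomorphic continuation to $(\mathbf s,\mathbf z)\in\mathbb C^r\times(\mathbb C\setminus\mathbb R_{\ge1})^r$, denoted by the same symbol. For $\mathbf s',\mathbf s\in\mathbb C^r$ with $\mathrm{Re}(s_j)>0$ for all $j$, put $$\eta(\mathbf s';\mathbf s)=\prod_{j=1}^r\frac1{\Gamma(s_j)}\int_0^\infty\!\!\cdots\int_0^\infty\frac{\mathrm{Li}_{\mathbf s'}(1-e^{t_1+\cdots+t_r},1-e^{t_2+\cdots+t_r},\dots,1-e^{t_r})}{(1-e^{t_1+\cdots+t_r})(1-e^{t_2+\cdots+t_r})\cdots(1-e^{t_r})}\prod_{j=1}^r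 t_j^{s_j-1}\,dt_j .$$ Then this integral converges absolutely, the function $\eta(\mathbf s';\mathbf s)$ extends to a holomorphic function on all of $\mathbb C^r\times\mathbb C^r$, and the extended function satisfies $\eta(\mathbf s';\mathbf s)=\eta(\mathbf s;\mathbf s')$ for all $\mathbf s',\mathbf s\in\mathbb C^r$. In particular, for $r=1$, the Kaneko–Tsumura function $\eta(k;s)=\frac1{\Gamma(s)}\int_0^\infty\frac{\mathrm{Li}_k(1-e^t)}{1-e^t}\,t^{s-1}\,dt$ ($k\in\mathbb C$, $\mathrm{Re}(s)>0$; the integral converges absolutely) extends to a holomorphic function on $\mathbb C\times\mathbb C$ satisfying $\eta(k;l)=\eta(l;k)$ for all $k,l\in\mathbb C$. -/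

import Mathlib

/-- The exponent `n_j - n_{j-1}` attached to `n_1 < ... < n_r`, with the convention `n_0 = 0`.
The index `j : Fin r` stands for the mathematical index `j + 1`. -/
def indexGap {r : ℕ} (n : Fin r → ℕ) (j : Fin r) : ℕ :=
  n j - (if (j : ℕ) = 0 then 0 else n ⟨(j : ℕ) - 1, lt_of_le_of_lt (Nat.sub_le _ _) j.isLt⟩)

/-- The set of integer tuples `0 < n_1 < ... < n_r`. -/
def PosStrictTuple (r : ℕ) : Type :=
  {n : Fin r → ℕ // StrictMono n ∧ ∀ j, 0 < n j}

/-- The term `z_1^{n_1} z_2^{n_2 - n_1} ... z_r^{n_r - n_{r-1}} / (n_1^{s_1} ... n_r^{s_r})`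
of the multiple polylogarithm series. -/
noncomputable def multiPolylogTerm {r : ℕ} (s z : Fin r → ℂ) (n : PosStrictTuple r) : ℂ :=
  ∏ j, z j ^ indexGap n.1 j / (n.1 j : ℂ) ^ s j

/-- The region `(ℂ ∖ ℝ_{≥ 1})^r`. -/
def cutRegion (r : ℕ) : Set (Fin r → ℂ) :=
  {z | ∀ j, ∀ x : ℝ, 1 ≤ x → z j ≠ (x : ℂ)}

/-- `L` is the holomorphic continuation to `ℂ^r × (ℂ ∖ ℝ_{≥ 1})^r` of the multiple polylogarithm
series, which converges (absolutely) for `|z_j| < 1` and arbitrary complex `s`. -/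
structure IsMultiPolylog (r : ℕ) (L : (Fin r → ℂ) → (Fin r → ℂ) → ℂ) : Prop where
  holo : DifferentiableOn ℂ (fun p : (Fin r → ℂ) × (Fin r → ℂ) => L p.1 p.2)
    (Set.univ ×ˢ cutRegion r)
  hasSum : ∀ s z : Fin r → ℂ, (∀ j, ‖z j‖ < 1) → HasSum (multiPolylogTerm s z) (L s z)

/-- The holomorphic continuation of the multiple polylogarithm is determined by the series. -/
theorem IsMultiPolylog.unique {r : ℕ} {L M : (Fin r → ℂ) → (Fin r → ℂ) → ℂ}
    (hL : IsMultiPolylog r L) (hM : IsMultiPolylog r M) (s z : Fin r → ℂ)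
    (hz : z ∈ cutRegion r) : L s z = M s z := by
  let U : Set ℂ := {w | w • z ∈ cutRegion r}
  have hcut : IsOpen (cutRegion r) := by
    have h : cutRegion r
        = ⋂ j, (fun z : Fin r → ℂ => z j) ⁻¹' ((fun x : ℝ => (x : ℂ)) '' Set.Ici 1)ᶜ := by
      ext z
      simp only [cutRegion, Set.mem_ofPred_eq, Set.mem_iInter, Set.mem_preimage,
        Set.mem_compl_iff, Set.mem_image, Set.mem_Ici, not_exists, not_and]
      exact forall_congr' fun j => forall_congr' fun x => forall_congr' fun _ => ne_comm
    rw [h]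
    refine isOpen_iInter_of_finite fun j => IsOpen.preimage (continuous_apply j) ?_
    exact (Complex.isometry_ofReal.isClosedEmbedding.isClosedMap _ isClosed_Ici).isOpen_compl
  have hU : IsOpen U := hcut.preimage (by fun_prop)
  have hstar : StarConvex ℝ (0 : ℂ) U := by
    intro w hw a b ha hb hab j x hx he
    simp only [smul_zero, zero_add, Pi.smul_apply, smul_eq_mul, Complex.real_smul] at he
    have hb0 : b ≠ 0 := by
      rintro rfl
      have : (x : ℂ) = ((0 : ℝ) : ℂ) := by rw [← he]; simp
      have := Complex.ofReal_injective this
      linarith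
    refine hw j (x / b) ?_ ?_
    · rw [le_div_iff₀ (lt_of_le_of_ne hb (Ne.symm hb0))]; linarith
    · have hbc : (b : ℂ) ≠ 0 := by exact_mod_cast hb0
      simp only [Pi.smul_apply, smul_eq_mul, Complex.ofReal_div]
      rw [eq_div_iff hbc, ← he]; ring
  have h0 : (0 : ℂ) ∈ U := by
    intro j x hx he
    have : (x : ℂ) = ((0 : ℝ) : ℂ) := by rw [← he]; simp
    have := Complex.ofReal_injective this
    linarith
  have hanal : ∀ K : (Fin r → ℂ) → (Fin r → ℂ) → ℂ, IsMultiPolylog r K →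
      AnalyticOnNhd ℂ (fun w : ℂ => K s (w • z)) U := by
    intro K hK
    refine DifferentiableOn.analyticOnNhd ?_ hU
    have hd : DifferentiableOn ℂ (fun w : ℂ => ((s, w • z) : (Fin r → ℂ) × (Fin r → ℂ))) U :=
      by fun_prop
    exact hK.holo.comp hd fun w hw => ⟨Set.mem_univ _, hw⟩
  have hev : (fun w : ℂ => L s (w • z)) =ᶠ[nhds 0] fun w : ℂ => M s (w • z) := by
    have hball : ∀ᶠ w in nhds (0 : ℂ), ∀ j, ‖(w • z) j‖ < 1 := by
      refine Filter.eventually_all.2 fun j => ?_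
      have hc : Continuous fun w : ℂ => ‖(w • z) j‖ := by fun_prop
      exact (hc.tendsto 0).eventually_lt_const (by simp)
    filter_upwards [hball] with w hw
    exact (hL.hasSum s _ hw).unique (hM.hasSum s _ hw)
  have h1 : (1 : ℂ) ∈ U := by simpa [U] using hz
  simpa using (hanal L hL).eqOn_of_preconnected_of_eventuallyEq (hanal M hM)
    (StarConvex.isPathConnected hstar h0).isConnected.isPreconnected h0 hev h1

/-- The multiple polylogarithm `Li_s(z)`: the holomorphic continuation of the multiple
polylogarithm series to `ℂ^r × (ℂ ∖ ℝ_{≥ 1})^r`. -/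
noncomputable def multiPolylog (r : ℕ) : (Fin r → ℂ) → (Fin r → ℂ) → ℂ :=
  Classical.epsilon (IsMultiPolylog r)

/-- The arguments `1 - e^{t_j + ... + t_r}`. -/
noncomputable def etaArg {r : ℕ} (t : Fin r → ℝ) (j : Fin r) : ℂ :=
  1 - Complex.exp ((∑ i ∈ Finset.Ici j, t i : ℝ) : ℂ)

/-- The integrand of the multiple integral defining `η(s'; s)`. -/
noncomputable def etaIntegrand {r : ℕ} (s' s : Fin r → ℂ) (t : Fin r → ℝ) : ℂ :=
  multiPolylog r s' (etaArg t) / (∏ j, etaArg t j) * ∏ j, (t j : ℂ) ^ (s j - 1)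

/-- The octant `(0, ∞)^r`. -/
def posOctant (r : ℕ) : Set (Fin r → ℝ) := {t | ∀ j, 0 < t j}

/-- The function `η(s'; s)` as the multiple integral, meaningful for `Re(s_j) > 0`. -/
noncomputable def etaIntegral {r : ℕ} (s' s : Fin r → ℂ) : ℂ :=
  (∏ j, 1 / Complex.Gamma (s j)) * ∫ t in posOctant r, etaIntegrand s' s t

/-- `E` is the holomorphic continuation of `η(s'; s)` to `ℂ^r × ℂ^r`: it is entire, and for
`Re(s_j) > 0` (and any `s'`) the multiple integral converges absolutely and is equal to `E`. -/
structure IsEtaContinuation (r : ℕ) (E : (Fin r → ℂ) → (Fin r → ℂ) → ℂ) : Prop where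
  holo : Differentiable ℂ (fun p : (Fin r → ℂ) × (Fin r → ℂ) => E p.1 p.2)
  integrable : ∀ s' s : Fin r → ℂ, (∀ j, 0 < (s j).re) →
    MeasureTheory.IntegrableOn (etaIntegrand s' s) (posOctant r)
  eq_integral : ∀ s' s : Fin r → ℂ, (∀ j, 0 < (s j).re) → E s' s = etaIntegral s' s

/-- The one-variable integrand `Li_k(1 - e^t) / (1 - e^t) * t^{s-1}` of Kaneko and Tsumura. -/
noncomputable def ktIntegrand (k s : ℂ) (t : ℝ) : ℂ :=
  multiPolylog 1 (fun _ => k) (fun _ => 1 - Complex.exp (t : ℂ)) / (1 - Complex.exp (t : ℂ))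
    * (t : ℂ) ^ (s - 1)

/-- `E` is the holomorphic continuation to `ℂ × ℂ` of the Kaneko-Tsumura function
`η(k; s) = 1 / Γ(s) * ∫_0^∞ Li_k(1 - e^t) / (1 - e^t) * t^{s-1} dt`, `Re(s) > 0`. -/
structure IsKanekoTsumuraEta (E : ℂ → ℂ → ℂ) : Prop where
  holo : Differentiable ℂ (fun p : ℂ × ℂ => E p.1 p.2)
  integrable : ∀ k s : ℂ, 0 < s.re →
    MeasureTheory.IntegrableOn (ktIntegrand k s) (Set.Ioi 0)
  eq_integral : ∀ k s : ℂ, 0 < s.re →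
    E k s = 1 / Complex.Gamma s * ∫ t in Set.Ioi (0 : ℝ), ktIntegrand k s t

/-! Write `X_i = x_i + ... + x_r` and `T_i = t_i + ... + t_r`. For `Re s_j > 0` and `|z_i| < 1`,
expanding geometric series and integrating termwise shows that `Li_s(z)` is `∏ z_i` times the Mellin
transform in `x`, divided by Gamma factors, of `∏ 1 / (e^{X_i} - z_i)`. At `z_i = 1 - e^{T_i}` this
kernel becomes `∏ 1 / (e^{X_i} + e^{T_i} - 1)`, and `∏ z_i` cancels the denominator of the `η`
integrand. Hence `η(s'; s)` is a normalised Mellin transform in `2r` variables of a kernel symmetric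
under `x ↔ t`, and exchanging the variables exchanges `s'` and `s` (`etaKernel_elim`,
`etaKernel_swap`, `gammaMellin_comp_equiv`).

Continuation in the exponents is integration by parts: because `Γ(s + 1) = s Γ(s)`, replacing the
kernel by `-∂/∂x_j` of it raises `s_j` by one without any other factor
(`gammaMellin_eq_add_single`). This can be repeated if all iterated partial derivatives decay
exponentially, which holds because they are combinations of products of the functions `ratioTerm`.
The continuations so obtained agree by the identity theorem
(`SmoothDecayFamily.exists_continuation`).

For arbitrary `s'` and `Re s_j > 0`, integrating by parts in `x` only and then applying Fubini gives
both the absolute convergence of the `η` integral and its equality with the continuation. -/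

open MeasureTheory Filter Topology Set

/-! ### Holomorphic dependence of integrals on parameters -/

/-- Cauchy's estimate for the derivative of a bounded holomorphic function on a ball. -/
theorem norm_fderiv_le_of_forall_mem_ball {E : Type*} [NormedAddCommGroup E] [NormedSpace ℂ E]
    {f : E → ℂ} {c : E} {R B : ℝ} (hR : 0 < R) (hd : DifferentiableOn ℂ f (Metric.ball c R))
    (hB : ∀ x ∈ Metric.ball c R, ‖f x‖ ≤ B) : ‖fderiv ℂ f c‖ ≤ 2 * B / R := by
  refine Complex.norm_fderiv_le_div_of_mapsTo_ball hd (fun x hx => ?_) hR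
  have h1 := hB x hx
  have h2 := hB c (Metric.mem_ball_self hR)
  rw [Metric.mem_closedBall, dist_eq_norm]
  linarith [norm_sub_le (f x) (f c)]

/-- The derivative of a holomorphic family of measurable functions is measurable. -/
theorem aestronglyMeasurable_fderiv_of_family {E α : Type*} [NormedAddCommGroup E]
    [NormedSpace ℂ E] [FiniteDimensional ℂ E] [MeasurableSpace α] {μ : Measure α}
    {f : E → α → ℂ} {c : E} {R : ℝ} (hR : 0 < R)
    (hm : ∀ x ∈ Metric.ball c R, AEStronglyMeasurable (f x) μ)
    (hd : ∀ᵐ a ∂μ, DifferentiableAt ℂ (f · a) c) :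
    AEStronglyMeasurable (fun a => fderiv ℂ (f · a) c) μ := by
  have key : ∀ v : E, AEStronglyMeasurable (fun a => fderiv ℂ (f · a) c v) μ := by
    intro v
    have hc : Tendsto (fun n : ℕ => ‖((n : ℂ))‖) atTop atTop := by
      simpa using tendsto_natCast_atTop_atTop (R := ℝ)
    have hc' : Tendsto (fun n : ℕ => c + ((n : ℂ))⁻¹ • v) atTop (𝓝 c) := by
      have : Tendsto (fun n : ℕ => ((n : ℂ))⁻¹) atTop (𝓝 0) :=
        tendsto_inv₀_cobounded.comp (tendsto_norm_atTop_iff_cobounded.1 hc)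
      simpa using (tendsto_const_nhds (x := c)).add (this.smul_const v)
    obtain ⟨N, hN⟩ := eventually_atTop.1 (hc'.eventually (Metric.ball_mem_nhds c hR))
    -- Difference quotients with step `1 / n` converge to the directional derivative; the shift by
    -- `N` keeps their base points in the ball where measurability is known.
    refine aestronglyMeasurable_of_tendsto_ae (u := atTop)
      (f := fun (n : ℕ) a => ((n + N : ℕ) : ℂ) • (f (c + (((n + N : ℕ) : ℂ))⁻¹ • v) a - f c a))
      (fun n => ((hm _ (hN _ (Nat.le_add_left _ _))).sub
        (hm _ (Metric.mem_ball_self hR))).const_smul ((n + N : ℕ) : ℂ)) ?_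
    filter_upwards [hd] with a ha
    exact (ha.hasFDerivAt.lim v hc).comp (tendsto_add_atTop_nat N)
  let b := Module.finBasis ℂ E
  have : (fun a => fderiv ℂ (f · a) c) = fun a => ∑ i, (fderiv ℂ (f · a) c (b i)) •
      (LinearMap.toContinuousLinearMap (b.coord i)) := by
    ext a v
    conv_lhs => rw [← b.sum_repr v, map_sum]
    simp [mul_comm]
  rw [this]
  exact Finset.aestronglyMeasurable_fun_sum _ fun i _ => (key (b i)).smul_const _

/-- A dominated integral of a holomorphic family is holomorphic in the parameter. -/
theorem differentiableAt_integral_of_dominated {E α : Type*} [NormedAddCommGroup E]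
    [NormedSpace ℂ E] [FiniteDimensional ℂ E] [MeasurableSpace α] {μ : Measure α}
    {f : E → α → ℂ} {c : E} {R : ℝ} {bound : α → ℝ} (hR : 0 < R)
    (hm : ∀ x ∈ Metric.ball c R, AEStronglyMeasurable (f x) μ)
    (hb : ∀ᵐ a ∂μ, ∀ x ∈ Metric.ball c R, ‖f x a‖ ≤ bound a) (hbi : Integrable bound μ)
    (hd : ∀ᵐ a ∂μ, DifferentiableOn ℂ (f · a) (Metric.ball c R)) :
    DifferentiableAt ℂ (fun x => ∫ a, f x a ∂μ) c := by
  have hc := Metric.mem_ball_self (x := c) hR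
  refine (hasFDerivAt_integral_of_dominated_of_fderiv_le (F' := fun x a => fderiv ℂ (f · a) x)
    (s := Metric.ball c (R / 2)) (bound := fun a => 2 * bound a / (R / 2))
    (Metric.ball_mem_nhds c (half_pos hR)) ?_ ?_ ?_ ?_ ?_ ?_).differentiableAt
  · filter_upwards [Metric.ball_mem_nhds c hR] with x hx using hm x hx
  · exact hbi.mono' (hm c hc) (hb.mono fun a ha => ha c hc)
  · exact aestronglyMeasurable_fderiv_of_family hR hm
      (hd.mono fun a ha => ha.differentiableAt (Metric.ball_mem_nhds c hR))
  · filter_upwards [hb, hd] with a ha hda x hx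
    have hsub : Metric.ball x (R / 2) ⊆ Metric.ball c R := by
      refine Metric.ball_subset_ball' ?_
      have := Metric.mem_ball.1 hx
      linarith
    exact norm_fderiv_le_of_forall_mem_ball (half_pos hR) (hda.mono hsub)
      fun y hy => ha y (hsub hy)
  · exact (hbi.const_mul 2).div_const _
  · filter_upwards [hd] with a ha x hx
    exact (ha.differentiableAt (Metric.isOpen_ball.mem_nhds
      (Metric.ball_subset_ball (by linarith) hx))).hasFDerivAt

/-! ### Mellin transforms over the octant -/

/-- The open octant `(0, ∞)^ι`. -/
def octant (ι : Type*) : Set (ι → ℝ) := {x | ∀ j, 0 < x j}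

/-- The Mellin transform over the octant, divided by the Gamma factors. -/
noncomputable def gammaMellin {ι : Type*} [Fintype ι] (F : (ι → ℝ) → ℂ) (s : ι → ℂ) : ℂ :=
  (∏ j, 1 / Complex.Gamma (s j)) * ∫ x in octant ι, F x * ∏ j, (x j : ℂ) ^ (s j - 1)

theorem differentiableOn_fun_prod {ι E : Type*} [Fintype ι] [NormedAddCommGroup E]
    [NormedSpace ℂ E] {f : ι → E → ℂ} {s : Set E} (h : ∀ i, DifferentiableOn ℂ (f i) s) :
    DifferentiableOn ℂ (fun x => ∏ i, f i x) s := by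
  classical
  exact fun x hx => (HasFDerivWithinAt.finsetProd
    fun i _ => (h i x hx).hasFDerivWithinAt).differentiableWithinAt

theorem differentiableAt_fun_prod {ι E : Type*} [Fintype ι] [NormedAddCommGroup E]
    [NormedSpace ℂ E] {f : ι → E → ℂ} {x : E} (h : ∀ i, DifferentiableAt ℂ (f i) x) :
    DifferentiableAt ℂ (fun x => ∏ i, f i x) x := by
  classical
  exact (HasFDerivAt.finsetProd fun i _ => (h i).hasFDerivAt).differentiableAt

section Mellin
variable {ι : Type*} [Fintype ι]

theorem octant_eq_pi (ι : Type*) : octant ι = Set.univ.pi fun _ => Ioi (0 : ℝ) := by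
  ext x; simp [octant]

theorem isOpen_octant : IsOpen (octant ι) := by
  rw [octant_eq_pi]; exact isOpen_set_pi finite_univ fun _ _ => isOpen_Ioi

theorem restrict_octant : (volume : Measure (ι → ℝ)).restrict (octant ι) =
    Measure.pi fun _ => volume.restrict (Ioi (0 : ℝ)) := by
  rw [octant_eq_pi, volume_pi, Measure.restrict_pi_pi]

theorem continuousOn_cpow_octant (s : ι → ℂ) :
    ContinuousOn (fun x : ι → ℝ => ∏ j, (x j : ℂ) ^ (s j)) (octant ι) := by
  refine continuousOn_finsetProd _ fun j _ => ?_
  refine ContinuousOn.cpow_const (by fun_prop) fun x hx => ?_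
  exact Complex.ofReal_mem_slitPlane.2 (hx j)

theorem integrableOn_rpow_mul_exp_neg_half {a : ℝ} (ha : 0 < a) :
    IntegrableOn (fun x : ℝ => x ^ (a - 1) * Real.exp (-x / 2)) (Ioi 0) := by
  have := integrableOn_rpow_mul_exp_neg_mul_rpow (p := 1) (s := a - 1) (b := 1 / 2)
    (by linarith) one_pos (by norm_num)
  refine this.congr_fun (fun x _ => ?_) measurableSet_Ioi
  simp only [Real.rpow_one]; ring_nf

/-- The dominating function for the Mellin integrand when `a j ≤ Re (s j) ≤ b j`. -/
theorem integrableOn_octant_majorant {a b : ι → ℝ} (ha : ∀ j, 0 < a j) (hb : ∀ j, 0 < b j) :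
    IntegrableOn (fun x : ι → ℝ => ∏ j, ((x j) ^ (a j - 1) + (x j) ^ (b j - 1)) *
      Real.exp (-(x j) / 2)) (octant ι) := by
  rw [IntegrableOn, restrict_octant]
  refine Integrable.fintype_prod (f := fun j y => (y ^ (a j - 1) + y ^ (b j - 1)) *
      Real.exp (-y / 2)) fun j => ?_
  simp only [add_mul]
  exact (integrableOn_rpow_mul_exp_neg_half (ha j)).add (integrableOn_rpow_mul_exp_neg_half (hb j))

/-- The power with exponent `a - 1` dominates on `(0, 1]` and the one with `b - 1` on `[1, ∞)`, so
their sum is a majorant uniform in the whole strip of exponents. -/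
theorem norm_cpow_sub_one_le {x a b : ℝ} {s : ℂ} (hx : 0 < x) (ha : a ≤ s.re) (hb : s.re ≤ b) :
    ‖(x : ℂ) ^ (s - 1)‖ ≤ x ^ (a - 1) + x ^ (b - 1) := by
  rw [Complex.norm_cpow_eq_rpow_re_of_pos hx, Complex.sub_re, Complex.one_re]
  rcases le_total 1 x with h | h
  · have := Real.rpow_le_rpow_of_exponent_le h (show s.re - 1 ≤ b - 1 by linarith)
    have := Real.rpow_nonneg hx.le (a - 1)
    linarith
  · have := Real.rpow_le_rpow_of_exponent_ge hx h (show a - 1 ≤ s.re - 1 by linarith)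
    have := Real.rpow_nonneg hx.le (b - 1)
    linarith

theorem norm_mellin_integrand_le {F : (ι → ℝ) → ℂ} {C : ℝ} {a b : ι → ℝ} {s : ι → ℂ}
    (ha : ∀ j, a j ≤ (s j).re) (hb : ∀ j, (s j).re ≤ b j) {x : ι → ℝ} (hx : x ∈ octant ι)
    (hF : ‖F x‖ ≤ C * Real.exp (-(∑ j, x j) / 2)) :
    ‖F x * ∏ j, (x j : ℂ) ^ (s j - 1)‖ ≤
      C * ∏ j, ((x j) ^ (a j - 1) + (x j) ^ (b j - 1)) * Real.exp (-(x j) / 2) := by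
  have h1 : Real.exp (-(∑ j, x j) / 2) = ∏ j, Real.exp (-(x j) / 2) := by
    rw [← Real.exp_sum, ← Finset.sum_neg_distrib, Finset.sum_div]
  rw [norm_mul, norm_prod, Finset.prod_mul_distrib, ← h1, mul_comm (∏ j, _), ← mul_assoc]
  exact mul_le_mul hF (Finset.prod_le_prod (fun _ _ => norm_nonneg _)
    fun j _ => norm_cpow_sub_one_le (hx j) (ha j) (hb j))
    (Finset.prod_nonneg fun _ _ => norm_nonneg _) ((norm_nonneg _).trans hF)

theorem integrableOn_mellin {F : (ι → ℝ) → ℂ} {C : ℝ} {s : ι → ℂ}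
    (hc : ContinuousOn F (octant ι))
    (hF : ∀ x ∈ octant ι, ‖F x‖ ≤ C * Real.exp (-(∑ j, x j) / 2)) (hs : ∀ j, 0 < (s j).re) :
    IntegrableOn (fun x => F x * ∏ j, (x j : ℂ) ^ (s j - 1)) (octant ι) := by
  refine Integrable.mono' ((integrableOn_octant_majorant hs hs).const_mul C)
    ((hc.mul (continuousOn_cpow_octant fun j => s j - 1)).aestronglyMeasurable
      isOpen_octant.measurableSet) ?_
  filter_upwards [ae_restrict_mem isOpen_octant.measurableSet] with x hx
  exact norm_mellin_integrand_le (fun _ => le_rfl) (fun _ => le_rfl) hx (hF x hx)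

/-- A holomorphic family of functions on the octant with locally uniform exponential decay. -/
structure DecayFamily {V : Type*} [NormedAddCommGroup V] [NormedSpace ℂ V] (U : Set V)
    (F : V → (ι → ℝ) → ℂ) : Prop where
  cont : ∀ z ∈ U, ContinuousOn (F z) (octant ι)
  holo : ∀ x ∈ octant ι, DifferentiableOn ℂ (fun z => F z x) U
  bound : ∀ z₀ ∈ U, ∃ C, ∀ᶠ z in 𝓝 z₀, ∀ x ∈ octant ι,
    ‖F z x‖ ≤ C * Real.exp (-(∑ j, x j) / 2)

variable {V : Type*} [NormedAddCommGroup V] [NormedSpace ℂ V]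

theorem DecayFamily.integrableOn {U : Set V} {F : V → (ι → ℝ) → ℂ} (hF : DecayFamily U F)
    {z : V} (hz : z ∈ U) {s : ι → ℂ} (hs : ∀ j, 0 < (s j).re) :
    IntegrableOn (fun x => F z x * ∏ j, (x j : ℂ) ^ (s j - 1)) (octant ι) := by
  obtain ⟨C, hC⟩ := hF.bound z hz
  exact integrableOn_mellin (hF.cont z hz) hC.self_of_nhds hs

/-- The Mellin transform of a decaying holomorphic family is jointly holomorphic. -/
theorem DecayFamily.differentiableAt_gammaMellin [FiniteDimensional ℂ V] {U : Set V}
    (hU : IsOpen U) {F : V → (ι → ℝ) → ℂ} (hF : DecayFamily U F) {s₀ : ι → ℂ} {z₀ : V}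
    (hs : ∀ j, 0 < (s₀ j).re) (hz : z₀ ∈ U) :
    DifferentiableAt ℂ (fun p : (ι → ℂ) × V => gammaMellin (F p.2) p.1) (s₀, z₀) := by
  unfold gammaMellin
  refine DifferentiableAt.mul ?_ ?_
  · refine differentiableAt_fun_prod fun j => ?_
    simp only [one_div]
    exact (Complex.differentiable_one_div_Gamma _).comp (s₀, z₀)
      (f := fun p : (ι → ℂ) × V => p.1 j) (by fun_prop)
  obtain ⟨C, hC⟩ := hF.bound z₀ hz
  obtain ⟨R₁, hR₁, h₁⟩ := Metric.eventually_nhds_iff_ball.1 (hC.and (hU.mem_nhds hz))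
  -- With `R₂` below every real part, the lower exponents `Re (s₀ j) - R₂` of the majorant stay
  -- positive, which integrability at `0` requires.
  obtain ⟨R₂, hR₂, h₂⟩ : ∃ R > 0, ∀ j, R < (s₀ j).re := by
    have : ∀ᶠ R in 𝓝[>] (0 : ℝ), ∀ j, R < (s₀ j).re :=
      eventually_all.2 fun j => nhdsWithin_le_nhds (eventually_lt_nhds (hs j))
    obtain ⟨R, h, hR⟩ := (this.and self_mem_nhdsWithin).exists
    exact ⟨R, hR, h⟩
  have hball : ∀ p ∈ Metric.ball (s₀, z₀) (min R₁ R₂), p.2 ∈ Metric.ball z₀ R₁ ∧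
      ∀ j, |(p.1 j).re - (s₀ j).re| ≤ R₂ := by
    intro p hp
    rw [← ball_prod_same] at hp
    refine ⟨Metric.ball_subset_ball (min_le_left _ _) hp.2, fun j => ?_⟩
    have h3 := (Metric.mem_ball.1 hp.1).trans_le (min_le_right _ _)
    have h4 := (dist_le_pi_dist p.1 s₀ j).trans h3.le
    rw [dist_eq_norm] at h4
    rw [← Complex.sub_re]
    exact (Complex.abs_re_le_norm _).trans h4
  have hre : ∀ p ∈ Metric.ball (s₀, z₀) (min R₁ R₂), ∀ j,
      (s₀ j).re - R₂ ≤ (p.1 j).re ∧ (p.1 j).re ≤ (s₀ j).re + R₂ := by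
    intro p hp j
    have := abs_le.1 ((hball p hp).2 j)
    constructor <;> linarith
  refine differentiableAt_integral_of_dominated (R := min R₁ R₂) (lt_min hR₁ hR₂)
    (bound := fun x => C * ∏ j, ((x j) ^ ((s₀ j).re - R₂ - 1) + (x j) ^ ((s₀ j).re + R₂ - 1)) *
      Real.exp (-(x j) / 2)) ?_ ?_ ?_ ?_
  · intro p hp
    exact (((hF.cont _ (h₁ _ (hball p hp).1).2).mul
      (continuousOn_cpow_octant fun j => p.1 j - 1)).aestronglyMeasurable
        isOpen_octant.measurableSet)
  · filter_upwards [ae_restrict_mem isOpen_octant.measurableSet] with x hx p hp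
    exact norm_mellin_integrand_le (fun j => (hre p hp j).1) (fun j => (hre p hp j).2) hx
      ((h₁ _ (hball p hp).1).1 x hx)
  · exact (integrableOn_octant_majorant (fun j => sub_pos.2 (h₂ j))
      (fun j => by linarith [hs j])).const_mul C
  · filter_upwards [ae_restrict_mem isOpen_octant.measurableSet] with x hx
    refine DifferentiableOn.mul ?_ ?_
    · exact (hF.holo x hx).comp (by fun_prop) fun p hp => (h₁ _ (hball p hp).1).2
    · refine differentiableOn_fun_prod fun j => ?_
      refine DifferentiableOn.const_cpow (by fun_prop) (Or.inl ?_)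
      exact_mod_cast (hx j).ne'

end Mellin

/-! ### Integration by parts -/

/-- Integration by parts against `y ^ (s - 1)` on the half-line. -/
theorem integral_Ioi_cpow_by_parts {u v : ℝ → ℂ} {s : ℂ} {C : ℝ} (hs : 0 < s.re)
    (hu : ∀ y, 0 < y → HasDerivAt u (-(v y)) y)
    (hb : ∀ y, 0 < y → ‖u y‖ ≤ C * Real.exp (-y / 2))
    (hi : IntegrableOn (fun y : ℝ => s * (y : ℂ) ^ (s - 1) * u y - (y : ℂ) ^ s * v y) (Ioi 0)) :
    ∫ y in Ioi (0 : ℝ), (s * (y : ℂ) ^ (s - 1) * u y - (y : ℂ) ^ s * v y) = 0 := by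
  have hs0 : s ≠ 0 := by rintro rfl; simp at hs
  have hbound : ∀ y : ℝ, 0 < y → ‖(y : ℂ) ^ s * u y‖ ≤ C * (y ^ s.re * Real.exp (-y / 2)) := by
    intro y hy
    rw [norm_mul, Complex.norm_cpow_eq_rpow_re_of_pos hy, mul_left_comm]
    exact mul_le_mul_of_nonneg_left (hb y hy) (Real.rpow_nonneg hy.le _)
  rw [integral_Ioi_of_hasDerivAt_of_tendsto (f := fun y : ℝ => (y : ℂ) ^ s * u y) (m := 0)
    ?_ ?_ hi ?_]
  · simp [hs0]
  -- Nothing is known about continuity of `u` at `0`; boundedness suffices, since `y ^ s` tends to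
  -- `0` there and `0 ^ s = 0` for `s ≠ 0`.
  · rw [← Ioi_insert, continuousWithinAt_insert_self]
    have h0 : Tendsto (fun y : ℝ => C * (y ^ s.re * Real.exp (-y / 2))) (𝓝[>] 0) (𝓝 0) := by
      have : ContinuousAt (fun y : ℝ => C * (y ^ s.re * Real.exp (-y / 2))) 0 := by
        refine continuousAt_const.mul ((Real.continuousAt_rpow_const _ _ (Or.inr hs.le)).mul ?_)
        fun_prop
      simpa [Real.zero_rpow hs.ne'] using this.tendsto.mono_left nhdsWithin_le_nhds
    have : Tendsto (fun y : ℝ => (y : ℂ) ^ s * u y) (𝓝[>] 0) (𝓝 0) :=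
      squeeze_zero_norm' (eventually_nhdsWithin_of_forall fun y hy => hbound y hy) h0
    simpa [ContinuousWithinAt, hs0] using this
  · intro y hy
    have h1 : HasDerivAt (fun y : ℝ => (y : ℂ) ^ s) (s * (y : ℂ) ^ (s - 1)) y :=
      hasDerivAt_ofReal_cpow_const (ne_of_gt hy) hs0
    convert! h1.mul (hu y hy) using 1
    ring
  · refine squeeze_zero_norm' ((eventually_gt_atTop 0).mono hbound) ?_
    have := (tendsto_rpow_mul_exp_neg_mul_atTop_nhds_zero s.re (1 / 2) (by norm_num)).const_mul C
    simp only [mul_zero] at this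
    refine this.congr fun y => ?_
    ring_nf

section Mellin
variable {ι : Type*} [Fintype ι] [DecidableEq ι]

theorem cpow_kernel_add_single {x : ι → ℝ} (hx : x ∈ octant ι) (s : ι → ℂ) (j : ι) :
    ∏ i, (x i : ℂ) ^ ((s + Pi.single j 1 : ι → ℂ) i - 1) = x j * ∏ i, (x i : ℂ) ^ (s i - 1) := by
  have h : ∀ i, (x i : ℂ) ^ ((s + Pi.single j 1 : ι → ℂ) i - 1) =
      (if i = j then (x j : ℂ) else 1) * (x i : ℂ) ^ (s i - 1) := by
    intro i
    rcases eq_or_ne i j with rfl | hij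
    · have : (x i : ℂ) ≠ 0 := by exact_mod_cast (hx i).ne'
      simp only [Pi.add_apply, Pi.single_eq_same, if_true]
      rw [show s i + 1 - 1 = 1 + (s i - 1) by ring, Complex.cpow_add _ _ this, Complex.cpow_one]
    · simp [hij]
  simp only [h, Finset.prod_mul_distrib, Finset.prod_ite_eq', Finset.mem_univ, if_true]

/-- An integral over the octant vanishes when all integrals along one coordinate do. -/
theorem integral_octant_eq_zero_of_update {H : (ι → ℝ) → ℂ} (j : ι)
    (hi : IntegrableOn H (octant ι))
    (h : ∀ x ∈ octant ι, IntegrableOn (fun y => H (Function.update x j y)) (Ioi 0) →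
      ∫ y in Ioi (0 : ℝ), H (Function.update x j y) = 0) :
    ∫ x in octant ι, H x = 0 := by
  rw [IntegrableOn, restrict_octant] at hi
  rw [restrict_octant]
  set ν : Measure ℝ := volume.restrict (Ioi (0 : ℝ))
  let e := MeasurableEquiv.piEquivPiSubtypeProd (fun _ : ι => ℝ) (· = j)
  have he := measurePreserving_piEquivPiSubtypeProd (fun _ : ι => ν) (· = j)
  let f := MeasurableEquiv.funUnique {i // i = j} ℝ
  let _ : Fintype {i // i = j} := Subtype.fintype (· = j)
  have hf : MeasurePreserving f (Measure.pi fun _ => ν) ν := by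
    convert! measurePreserving_funUnique ν {i // i = j}
  let g := (MeasurableEquiv.prodCongr f.symm (MeasurableEquiv.refl ({i // i ≠ j} → ℝ))).trans
    e.symm
  have hg : MeasurePreserving g (ν.prod (Measure.pi fun _ => ν)) (Measure.pi fun _ => ν) :=
    (he.symm _).comp ((hf.symm _).prod (MeasurePreserving.id _))
  rw [← hg.integral_comp']
  rw [← hg.integrable_comp_emb g.measurableEmbedding] at hi
  change ∫ z, (H ∘ g) z ∂_ = 0
  rw [integral_prod_symm _ hi]
  refine integral_eq_zero_of_ae ?_
  have hpos : ∀ᵐ b ∂(Measure.pi fun _ : {i // i ≠ j} => ν), ∀ i, 0 < b i := by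
    refine ae_all_iff.2 fun i => ?_
    exact (Measure.tendsto_eval_ae_ae (i := i)).eventually (ae_restrict_mem measurableSet_Ioi)
  -- Fubini yields integrability only along almost every slice; this is why the slice hypothesis may
  -- assume integrability.
  filter_upwards [hpos, hi.prod_left_ae] with b hb hbi
  have hgi : ∀ y i, g (y, b) i = if h : i = j then y else b ⟨i, h⟩ := fun _ _ => rfl
  obtain ⟨x, hx, hup⟩ : ∃ x ∈ octant ι, ∀ y, g (y, b) = Function.update x j y := by
    refine ⟨g (1, b), fun i => ?_, fun y => ?_⟩
    · rw [hgi]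
      split_ifs with hij
      · exact one_pos
      · exact hb ⟨i, hij⟩
    · ext i
      rcases eq_or_ne i j with rfl | hij
      · simp [hgi]
      · simp [hgi, hij]
  simp only [Function.comp_def, hup] at hbi
  simp only [Function.comp_def, hup, Pi.zero_apply]
  exact h x hx hbi

omit [Fintype ι] in
theorem update_mem_octant {x : ι → ℝ} (hx : x ∈ octant ι) (j : ι) {y : ℝ} (hy : 0 < y) :
    Function.update x j y ∈ octant ι := by
  intro i
  rcases eq_or_ne i j with rfl | hij
  · simpa
  · simpa [hij] using hx i

/-- Integration by parts raises one exponent of the Mellin transform. -/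
theorem gammaMellin_eq_add_single {F G : (ι → ℝ) → ℂ} {j : ι} {C D : ℝ} {s : ι → ℂ}
    (hd : ∀ x ∈ octant ι, HasDerivAt (fun y => F (Function.update x j y)) (-(G x)) (x j))
    (hFc : ContinuousOn F (octant ι)) (hGc : ContinuousOn G (octant ι))
    (hFb : ∀ x ∈ octant ι, ‖F x‖ ≤ C * Real.exp (-(∑ j, x j) / 2))
    (hGb : ∀ x ∈ octant ι, ‖G x‖ ≤ D * Real.exp (-(∑ j, x j) / 2))
    (hs : ∀ i, 0 < (s i).re) :
    gammaMellin F s = gammaMellin G (s + Pi.single j 1) := by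
  have hs' : ∀ i, 0 < ((s + Pi.single j 1 : ι → ℂ) i).re := by
    intro i
    rcases eq_or_ne i j with rfl | hij
    · simpa using (hs i).trans (by linarith)
    · simpa [hij] using hs i
  have hs0 : s j ≠ 0 := by intro h; simpa [h] using hs j
  have hF := integrableOn_mellin hFc hFb hs
  have hG := integrableOn_mellin hGc hGb hs'
  -- The integrand is the `x_j`-derivative of `x_j ^ s_j * F` times the powers of the other
  -- coordinates, so its integral along each line in direction `j` is a boundary term.
  have key : ∫ x in octant ι, (s j * (F x * ∏ i, (x i : ℂ) ^ (s i - 1)) -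
      G x * ∏ i, (x i : ℂ) ^ ((s + Pi.single j 1 : ι → ℂ) i - 1)) = 0 := by
    refine integral_octant_eq_zero_of_update j ((hF.const_mul (s j)).sub hG) fun x hx hint => ?_
    set P : ℂ := ∏ i ∈ Finset.univ.erase j, (x i : ℂ) ^ (s i - 1)
    have hP : ∀ y : ℝ, ∏ i, ((Function.update x j y i : ℝ) : ℂ) ^ (s i - 1) =
        (y : ℂ) ^ (s j - 1) * P := by
      intro y
      rw [← Finset.mul_prod_erase _ _ (Finset.mem_univ j)]
      simp only [Function.update_self, P]
      congr 1
      exact Finset.prod_congr rfl fun i hi => by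
        rw [Function.update_of_ne (Finset.ne_of_mem_erase hi)]
    have heq : ∀ y ∈ Ioi (0 : ℝ), s j * (F (Function.update x j y) *
        ∏ i, ((Function.update x j y i : ℝ) : ℂ) ^ (s i - 1)) - G (Function.update x j y) *
        ∏ i, ((Function.update x j y i : ℝ) : ℂ) ^ ((s + Pi.single j 1 : ι → ℂ) i - 1) =
        (s j * (y : ℂ) ^ (s j - 1) * (P * F (Function.update x j y)) -
          (y : ℂ) ^ (s j) * (P * G (Function.update x j y))) := by
      intro y hy
      have hy0 : (y : ℂ) ≠ 0 := by exact_mod_cast (ne_of_gt hy)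
      rw [cpow_kernel_add_single (update_mem_octant hx j hy), hP, Function.update_self,
        Complex.cpow_sub _ _ hy0, Complex.cpow_one]
      field_simp
    rw [setIntegral_congr_fun measurableSet_Ioi heq]
    refine integral_Ioi_cpow_by_parts (hs j) (C := ‖P‖ * C) ?_ ?_
      (hint.congr_fun heq measurableSet_Ioi)
    · intro y hy
      have := hd _ (update_mem_octant hx j hy)
      simp only [Function.update_idem, Function.update_self] at this
      simpa using this.const_mul P
    · intro y hy
      have hxy := update_mem_octant hx j hy
      have h1 := hFb _ hxy
      have hC : 0 ≤ C := by
        have := (norm_nonneg _).trans h1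
        exact nonneg_of_mul_nonneg_left this (Real.exp_pos _)
      rw [norm_mul, mul_assoc]
      refine mul_le_mul_of_nonneg_left (h1.trans ?_) (norm_nonneg _)
      refine mul_le_mul_of_nonneg_left (Real.exp_le_exp.2 ?_) hC
      have : Function.update x j y j ≤ ∑ i, Function.update x j y i :=
        Finset.single_le_sum (fun i _ => (hxy i).le) (Finset.mem_univ j)
      rw [Function.update_self] at this
      linarith
  rw [integral_sub (hF.const_mul (s j)) hG, integral_const_mul, sub_eq_zero] at key
  -- The factor `s j` produced by integration by parts is absorbed by `Γ(s + 1) = s Γ(s)`.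
  have hgam : ∏ i, 1 / Complex.Gamma (s i) =
      s j * ∏ i, 1 / Complex.Gamma ((s + Pi.single j 1 : ι → ℂ) i) := by
    conv_lhs => rw [← Finset.mul_prod_erase _ _ (Finset.mem_univ j)]
    conv_rhs => rw [← Finset.mul_prod_erase _ _ (Finset.mem_univ j), ← mul_assoc]
    congr 1
    · simp only [Pi.add_apply, Pi.single_eq_same]
      rw [Complex.Gamma_add_one _ hs0]
      field_simp
    · exact Finset.prod_congr rfl fun i hi => by simp [Finset.ne_of_mem_erase hi]
  rw [gammaMellin, gammaMellin, hgam, ← key]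
  ring

end Mellin

/-! ### Continuation of Mellin transforms to all exponents -/

section Mellin
variable {ι : Type*} [DecidableEq ι]

/-- The operator `-∂/∂x_j`. -/
noncomputable def negPartial (j : ι) (F : (ι → ℝ) → ℂ) (x : ι → ℝ) : ℂ :=
  -deriv (fun y => F (Function.update x j y)) (x j)

/-- Iterated application of the operators `-∂/∂x_j`. -/
noncomputable def iterNegPartial (l : List ι) (F : (ι → ℝ) → ℂ) : (ι → ℝ) → ℂ :=
  l.foldr negPartial F

/-- The multiplicities of a list, as an exponent vector. -/
def countVec (l : List ι) (j : ι) : ℂ := l.count j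

theorem countVec_cons (j : ι) (l : List ι) : countVec (j :: l) = countVec l + Pi.single j 1 := by
  ext i
  rcases eq_or_ne i j with rfl | h
  · simp [countVec]
  · simp [countVec, h, List.count_cons_of_ne (Ne.symm h)]

theorem re_countVec_nonneg (l : List ι) (j : ι) : 0 ≤ (countVec l j).re := by
  simp [countVec]

variable [Fintype ι] {V : Type*} [NormedAddCommGroup V] [NormedSpace ℂ V]

/-- A holomorphic family all of whose iterated partial derivatives decay. -/
structure SmoothDecayFamily (U : Set V) (F : V → (ι → ℝ) → ℂ) : Prop where
  decay : ∀ l, DecayFamily U fun z => iterNegPartial l (F z)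
  diff : ∀ l j, ∀ z ∈ U, ∀ x ∈ octant ι,
    DifferentiableAt ℝ (fun y => iterNegPartial l (F z) (Function.update x j y)) (x j)

/-- Each entry of `l` is one integration by parts. The right side still converges when only `s +
countVec l` has positive real parts, and so provides the continuation. -/
theorem SmoothDecayFamily.gammaMellin_eq {U : Set V} {F : V → (ι → ℝ) → ℂ}
    (hF : SmoothDecayFamily U F) (l : List ι) {z : V} (hz : z ∈ U) {s : ι → ℂ}
    (hs : ∀ j, 0 < (s j).re) :
    gammaMellin (F z) s = gammaMellin (iterNegPartial l (F z)) (s + countVec l) := by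
  induction l with
  | nil =>
    have : countVec ([] : List ι) = 0 := by ext; simp [countVec]
    simp [this, iterNegPartial]
  | cons j l ih =>
    rw [ih, countVec_cons, ← add_assoc]
    obtain ⟨C, hC⟩ := (hF.decay l).bound z hz
    obtain ⟨D, hD⟩ := (hF.decay (j :: l)).bound z hz
    refine gammaMellin_eq_add_single (fun x hx => ?_) ((hF.decay l).cont z hz)
      ((hF.decay (j :: l)).cont z hz) hC.self_of_nhds hD.self_of_nhds fun i => ?_
    · convert! (hF.diff l j z hz x hx).hasDerivAt using 1
      simp [iterNegPartial, negPartial]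
    · have := re_countVec_nonneg l i
      have := hs i
      simp only [Pi.add_apply, Complex.add_re]
      linarith

omit [DecidableEq ι] in
/-- Holomorphic functions on a convex open set that agree on `Re (s j) > 0` agree everywhere. -/
theorem eqOn_of_eqOn_re_pos {A : Set (ι → ℂ)} (hA : IsOpen A) (hconv : Convex ℝ A)
    (hone : (1 : ι → ℂ) ∈ A) {f g : (ι → ℂ) → ℂ} (hf : DifferentiableOn ℂ f A)
    (hg : DifferentiableOn ℂ g A) (h : ∀ s, (∀ j, 0 < (s j).re) → f s = g s) : EqOn f g A := by
  intro s hs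
  -- Restricting to the complex line through `1` and `s` reduces the claim to the identity theorem
  -- in one variable: near `w = 0` the points lie in the region of known agreement.
  let u : ℂ → ι → ℂ := fun w => 1 + w • (s - 1)
  have hu : Differentiable ℂ u := by fun_prop
  have hU : IsOpen (u ⁻¹' A) := hA.preimage hu.continuous
  have hpre : IsPreconnected (u ⁻¹' A) := by
    refine Convex.isPreconnected fun w hw v hv a b ha hb hab => ?_
    have : u (a • w + b • v) = a • u w + b • u v := by
      have h1 : (a : ℂ) + b = 1 := by exact_mod_cast hab
      ext i
      simp only [u, Pi.add_apply, Pi.smul_apply, Pi.sub_apply, Pi.one_apply, smul_eq_mul,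
        Complex.real_smul]
      linear_combination -h1
    rw [mem_preimage, this]
    exact hconv hw hv ha hb hab
  have h0 : (0 : ℂ) ∈ u ⁻¹' A := by simpa [u] using hone
  have h1 : (1 : ℂ) ∈ u ⁻¹' A := by simpa [u] using hs
  have hev : (f ∘ u) =ᶠ[𝓝 0] (g ∘ u) := by
    have : ∀ᶠ w in 𝓝 (0 : ℂ), ∀ j, 0 < (u w j).re := by
      refine eventually_all.2 fun j => ?_
      have hc : Continuous fun w => (u w j).re := by fun_prop
      exact (hc.tendsto 0).eventually_const_lt (by simp [u])
    filter_upwards [this] with w hw using h _ hw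
  have := ((hf.comp hu.differentiableOn fun w hw => hw).analyticOnNhd
    hU).eqOn_of_preconnected_of_eventuallyEq
    ((hg.comp hu.differentiableOn fun w hw => hw).analyticOnNhd hU) hpre h0 hev h1
  simpa [u] using this

theorem exists_list_count_eq (N : ℕ) : ∃ l : List ι, ∀ j, l.count j = N := by
  induction N with
  | zero => exact ⟨[], fun _ => rfl⟩
  | succ N ih =>
    obtain ⟨l, hl⟩ := ih
    refine ⟨l ++ Finset.univ.toList, fun j => ?_⟩
    rw [List.count_append, hl, List.count_eq_one_of_mem (Finset.nodup_toList _) (by simp)]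

omit [DecidableEq ι] in
theorem isOpen_re_lt (a : ι → ℝ) : IsOpen {s : ι → ℂ | ∀ j, a j < (s j).re} := by
  simp only [Set.ofPred_forall]
  exact isOpen_iInter_of_finite fun j => isOpen_lt continuous_const (by fun_prop)

omit [DecidableEq ι] [Fintype ι] in
theorem convex_re_lt (a : ι → ℝ) : Convex ℝ {s : ι → ℂ | ∀ j, a j < (s j).re} := by
  simp only [Set.ofPred_forall]
  refine convex_iInter fun j => ?_
  exact (convex_Ioi (a j)).linear_preimage 
    (Complex.reLm ∘ₗ LinearMap.proj (R := ℝ) (φ := fun _ : ι => ℂ) j)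

/-- The Mellin transform of a smooth decaying family continues to all exponents. -/
theorem SmoothDecayFamily.exists_continuation [FiniteDimensional ℂ V] {U : Set V} (hU : IsOpen U)
    {F : V → (ι → ℝ) → ℂ} (hF : SmoothDecayFamily U F) :
    ∃ G : (ι → ℂ) → V → ℂ,
      DifferentiableOn ℂ (fun p : (ι → ℂ) × V => G p.1 p.2) (Set.univ ×ˢ U) ∧
      ∀ (l : List ι) (s : ι → ℂ), ∀ z ∈ U, (∀ j, 0 < ((s + countVec l) j).re) →
        G s z = gammaMellin (iterNegPartial l (F z)) (s + countVec l) := by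
  have hdiff : ∀ (l : List ι) (s : ι → ℂ), ∀ z ∈ U, (∀ j, 0 < ((s + countVec l) j).re) →
      DifferentiableAt ℂ (fun p : (ι → ℂ) × V =>
        gammaMellin (iterNegPartial l (F p.2)) (p.1 + countVec l)) (s, z) := by
    intro l s z hz hs
    exact ((hF.decay l).differentiableAt_gammaMellin hU hs hz).comp (s, z)
      (f := fun p : (ι → ℂ) × V => (p.1 + countVec l, p.2)) (by fun_prop)
  have hcons : ∀ (l m : List ι) (s : ι → ℂ), ∀ z ∈ U, (∀ j, 0 < ((s + countVec l) j).re) →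
      (∀ j, 0 < ((s + countVec m) j).re) →
      gammaMellin (iterNegPartial l (F z)) (s + countVec l) =
        gammaMellin (iterNegPartial m (F z)) (s + countVec m) := by
    intro l m s z hz hl hm
    -- Both shifted exponents have positive real parts on the convex region cut out by `a`; it
    -- contains `Re t_j > 0`, where both sides equal the unshifted transform.
    let a : ι → ℝ := fun j => max (-(countVec l j).re) (-(countVec m j).re)
    have hmem : ∀ t : ι → ℂ, (∀ j, a j < (t j).re) →
        (∀ j, 0 < ((t + countVec l) j).re) ∧ (∀ j, 0 < ((t + countVec m) j).re) := by
      intro t ht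
      refine ⟨fun j => ?_, fun j => ?_⟩ <;> have := max_lt_iff.1 (ht j) <;>
        simp only [Pi.add_apply, Complex.add_re] <;> linarith
    have hz' : Differentiable ℂ fun t : ι → ℂ => (t, z) := by fun_prop
    refine eqOn_of_eqOn_re_pos (isOpen_re_lt a) (convex_re_lt a) (fun j => ?_)
      (f := fun t => gammaMellin (iterNegPartial l (F z)) (t + countVec l))
      (g := fun t => gammaMellin (iterNegPartial m (F z)) (t + countVec m))
      (fun t ht => ?_) (fun t ht => ?_) (fun t ht => ?_) (x := s) (fun j => ?_)
    · have h1 := re_countVec_nonneg l j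
      have h2 := re_countVec_nonneg m j
      simp only [Pi.one_apply, Complex.one_re, a, max_lt_iff]
      constructor <;> linarith
    · exact ((hdiff l t z hz (hmem t ht).1).comp t (hz' t)).differentiableWithinAt
    · exact ((hdiff m t z hz (hmem t ht).2).comp t (hz' t)).differentiableWithinAt
    · exact (hF.gammaMellin_eq l hz ht).symm.trans (hF.gammaMellin_eq m hz ht)
    · have h1 := hl j
      have h2 := hm j
      simp only [Pi.add_apply, Complex.add_re] at h1 h2
      exact max_lt (by linarith) (by linarith)
  have hex : ∀ s : ι → ℂ, ∃ l : List ι, ∀ j, 0 < ((s + countVec l) j).re := by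
    intro s
    obtain ⟨N, hN⟩ := exists_nat_gt (∑ j, |(s j).re|)
    obtain ⟨l, hl⟩ := exists_list_count_eq (ι := ι) N
    refine ⟨l, fun j => ?_⟩
    have h1 := Finset.single_le_sum (f := fun j => |(s j).re|) (fun _ _ => abs_nonneg _)
      (Finset.mem_univ j)
    have h2 := neg_abs_le (s j).re
    simp only [Pi.add_apply, Complex.add_re, countVec, hl, Complex.natCast_re]
    linarith
  choose L hL using hex
  refine ⟨fun s z => gammaMellin (iterNegPartial (L s) (F z)) (s + countVec (L s)),
    fun p hp => ?_, fun l s z hz hs => hcons _ _ _ _ hz (hL s) hs⟩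
  refine DifferentiableAt.differentiableWithinAt ?_
  -- The chosen list `L s` may jump with `s`, but near `p` the fixed list `L p.1` is also admissible
  -- and gives the same value by `hcons`.
  refine (hdiff (L p.1) p.1 p.2 hp.2 (hL p.1)).congr_of_eventuallyEq ?_
  have h1 : ∀ᶠ q : (ι → ℂ) × V in 𝓝 p, q.2 ∈ U :=
    (continuous_snd.tendsto p).eventually (hU.mem_nhds hp.2)
  have h2 : ∀ᶠ q : (ι → ℂ) × V in 𝓝 p, ∀ j, 0 < ((q.1 + countVec (L p.1)) j).re := by
    refine eventually_all.2 fun j => ?_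
    have hc : Continuous fun q : (ι → ℂ) × V => ((q.1 + countVec (L p.1)) j).re := by
      fun_prop
    exact (hc.tendsto p).eventually_const_lt (hL p.1 j)
  filter_upwards [h1, h2] with q hq1 hq2
  exact hcons _ _ _ _ hq1 (hL q.1) hq2

end Mellin

/-! ### Classes of decaying functions stable under differentiation -/

section DerivClass
variable {ι : Type*} [DecidableEq ι] [Fintype ι] {V : Type*} [NormedAddCommGroup V]
  [NormedSpace ℂ V]

/-- A set of holomorphic families on the octant that decay like `exp (-ℓ / 2)` and whose partial
derivatives are linear combinations of members of the set. -/
structure DerivClass (U : Set V) (ℓ : (ι → ℝ) → ℝ) (A : Set (V → (ι → ℝ) → ℂ)) : Prop where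
  cont : ∀ F ∈ A, ∀ z ∈ U, ContinuousOn (F z) (octant ι)
  holo : ∀ F ∈ A, ∀ x ∈ octant ι, DifferentiableOn ℂ (fun z => F z x) U
  bound : ∀ F ∈ A, ∀ z₀ ∈ U, ∃ C, ∀ᶠ z in 𝓝 z₀, ∀ x ∈ octant ι,
    ‖F z x‖ ≤ C * Real.exp (-(ℓ x) / 2)
  deriv : ∀ F ∈ A, ∀ j, ∃ G ∈ Submodule.span ℂ A, ∀ z ∈ U, ∀ x ∈ octant ι,
    HasDerivAt (fun y => F z (Function.update x j y)) (-(G z x)) (x j)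

omit [Fintype ι] in
-- All four conditions are linear. Passing to the span is what allows derivatives to be
-- differentiated again.
theorem DerivClass.span {U : Set V} {ℓ : (ι → ℝ) → ℝ} {A : Set (V → (ι → ℝ) → ℂ)}
    (h : DerivClass U ℓ A) : DerivClass U ℓ (Submodule.span ℂ A : Set (V → (ι → ℝ) → ℂ)) where
  cont F hF z hz := by
    induction hF using Submodule.span_induction with
    | mem F hF => exact h.cont F hF z hz
    | zero => exact continuousOn_const
    | add F G _ _ hF hG => exact hF.add hG
    | smul c F _ hF => exact hF.const_smul c
  holo F hF x hx := by
    induction hF using Submodule.span_induction with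
    | mem F hF => exact h.holo F hF x hx
    | zero => exact differentiableOn_const _
    | add F G _ _ hF hG => exact hF.add hG
    | smul c F _ hF => exact hF.const_smul c
  bound F hF z₀ hz := by
    induction hF using Submodule.span_induction with
    | mem F hF => exact h.bound F hF z₀ hz
    | zero => exact ⟨0, by simp⟩
    | add F G _ _ hF hG =>
      obtain ⟨C, hC⟩ := hF
      obtain ⟨D, hD⟩ := hG
      refine ⟨C + D, (hC.and hD).mono fun z hz x hx => ?_⟩
      rw [add_mul]
      exact (norm_add_le _ _).trans (add_le_add (hz.1 x hx) (hz.2 x hx))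
    | smul c F _ hF =>
      obtain ⟨C, hC⟩ := hF
      refine ⟨‖c‖ * C, hC.mono fun z hz x hx => ?_⟩
      rw [Pi.smul_apply, Pi.smul_apply, norm_smul, mul_assoc]
      exact mul_le_mul_of_nonneg_left (hz x hx) (norm_nonneg _)
  deriv F hF j := by
    rw [Submodule.span_span]
    induction hF using Submodule.span_induction with
    | mem F hF => exact h.deriv F hF j
    | zero => exact ⟨0, zero_mem _, fun z _ x _ => by simpa using hasDerivAt_const (x j) (0 : ℂ)⟩
    | add F G _ _ hF hG =>
      obtain ⟨F', hF', hF⟩ := hF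
      obtain ⟨G', hG', hG⟩ := hG
      refine ⟨F' + G', add_mem hF' hG', fun z hz x hx => ?_⟩
      have := (hF z hz x hx).add (hG z hz x hx)
      rwa [← neg_add] at this
    | smul c F _ hF =>
      obtain ⟨F', hF', hF⟩ := hF
      refine ⟨c • F', Submodule.smul_mem _ c hF', fun z hz x hx => ?_⟩
      have := (hF z hz x hx).const_smul c
      rwa [smul_neg] at this

omit [Fintype ι] in
-- Decay rates add under multiplication, and by the Leibniz rule a derivative is a sum of products
-- with one factor differentiated. Factors are taken from the spans because that is where these
-- derivatives lie.
theorem DerivClass.prod {R : Type*} [Fintype R] {U : Set V} {ℓ : R → (ι → ℝ) → ℝ}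
    {A : R → Set (V → (ι → ℝ) → ℂ)} (h : ∀ i, DerivClass U (ℓ i) (A i)) :
    DerivClass U (fun x => ∑ i, ℓ i x) {F | ∃ f : R → V → (ι → ℝ) → ℂ,
      (∀ i, f i ∈ Submodule.span ℂ (A i)) ∧ F = fun z x => ∏ i, f i z x} where
  cont := by
    rintro _ ⟨f, hf, rfl⟩ z hz
    exact continuousOn_finsetProd _ fun i _ => (h i).span.cont _ (hf i) z hz
  holo := by
    rintro _ ⟨f, hf, rfl⟩ x hx
    exact differentiableOn_fun_prod fun i => (h i).span.holo _ (hf i) x hx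
  bound := by
    rintro _ ⟨f, hf, rfl⟩ z₀ hz
    choose C hC using fun i => (h i).span.bound _ (hf i) z₀ hz
    refine ⟨∏ i, C i, (eventually_all.2 hC).mono fun z hz x hx => ?_⟩
    rw [← Finset.sum_neg_distrib, Finset.sum_div, Real.exp_sum, ← Finset.prod_mul_distrib,
      norm_prod]
    exact Finset.prod_le_prod (fun _ _ => norm_nonneg _) fun i _ => hz i x hx
  deriv := by
    classical
    rintro _ ⟨f, hf, rfl⟩ j
    choose G hG hd using fun i => (h i).span.deriv _ (hf i) j
    refine ⟨∑ i, fun z x => ∏ k, Function.update f i (G i) k z x,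
      sum_mem fun i _ => Submodule.subset_span ⟨_, fun k => ?_, rfl⟩, fun z hz x hx => ?_⟩
    · rcases eq_or_ne k i with rfl | hk
      · simpa [Submodule.span_span] using hG k
      · simpa [hk] using hf k
    · convert! HasDerivAt.fun_finsetProd (u := Finset.univ) fun i _ => hd i z hz x hx using 1
      simp only [Finset.sum_apply, ← Finset.sum_neg_distrib, Function.update_eq_self]
      refine Finset.sum_congr rfl fun i _ => ?_
      rw [← Finset.mul_prod_erase _ _ (Finset.mem_univ i), Function.update_self, smul_eq_mul,
        mul_neg, mul_comm]
      congr 2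
      exact Finset.prod_congr rfl fun k hk => by
        rw [Function.update_of_ne (Finset.ne_of_mem_erase hk)]

theorem DerivClass.smoothDecayFamily {U : Set V} (hU : IsOpen U) {ℓ : (ι → ℝ) → ℝ}
    {A : Set (V → (ι → ℝ) → ℂ)}
    (h : DerivClass U ℓ A) (hℓ : ∀ x ∈ octant ι, ∑ j, x j ≤ ℓ x) {F : V → (ι → ℝ) → ℂ}
    (hF : F ∈ A) : SmoothDecayFamily U F := by
  have key : ∀ l : List ι, ∃ G ∈ Submodule.span ℂ A, ∀ z ∈ U, ∀ x ∈ octant ι,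
      iterNegPartial l (F z) x = G z x := by
    intro l
    induction l with
    | nil => exact ⟨F, Submodule.subset_span hF, fun _ _ _ _ => rfl⟩
    | cons j l ih =>
      obtain ⟨G, hG, hFG⟩ := ih
      obtain ⟨G', hG', hd⟩ := h.span.deriv G hG j
      rw [Submodule.span_span] at hG'
      refine ⟨G', hG', fun z hz x hx => ?_⟩
      -- The induction hypothesis holds only on the octant; openness in the direction `j` suffices
      -- to identify the derivatives.
      have hev : (fun y => iterNegPartial l (F z) (Function.update x j y)) =ᶠ[𝓝 (x j)]
          fun y => G z (Function.update x j y) := by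
        filter_upwards [lt_mem_nhds (hx j)] with y hy
        exact hFG z hz _ (update_mem_octant hx j hy)
      change -_root_.deriv (fun y => iterNegPartial l (F z) (Function.update x j y)) (x j) = _
      rw [hev.deriv_eq, (hd z hz x hx).deriv, neg_neg]
  constructor
  · intro l
    obtain ⟨G, hG, hFG⟩ := key l
    refine ⟨fun z hz => (h.span.cont G hG z hz).congr (hFG z hz),
      fun x hx => (h.span.holo G hG x hx).congr fun z hz => hFG z hz x hx, fun z₀ hz => ?_⟩
    obtain ⟨C, hC⟩ := h.span.bound G hG z₀ hz
    refine ⟨C, (hC.and (hU.mem_nhds hz)).mono fun z hz x hx => ?_⟩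
    rw [hFG z hz.2 x hx]
    have h1 := hz.1 x hx
    have hC0 : 0 ≤ C := nonneg_of_mul_nonneg_left ((norm_nonneg _).trans h1) (Real.exp_pos _)
    refine h1.trans (mul_le_mul_of_nonneg_left (Real.exp_le_exp.2 ?_) hC0)
    have := hℓ x hx
    linarith
  · intro l j z hz x hx
    obtain ⟨G, hG, hFG⟩ := key l
    obtain ⟨G', hG', hd⟩ := h.span.deriv G hG j
    refine (hd z hz x hx).differentiableAt.congr_of_eventuallyEq ?_
    filter_upwards [lt_mem_nhds (hx j)] with y hy
    exact hFG z hz _ (update_mem_octant hx j hy)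

/-- The functions `p ^ k * q ^ l / (p + q - w) ^ m`. -/
noncomputable def ratioTerm (k l m : ℕ) (p q w : ℂ) : ℂ := p ^ k * q ^ l * ((p + q - w) ^ m)⁻¹

/-- Since `P' = a P` and `Q' = b Q`, differentiating the numerator only rescales the term, and
differentiating the denominator raises `m` and one of `k`, `l` by one. Thus `m - k - l`, and with it
the condition `k + l < m`, is preserved. -/
theorem hasDerivAt_ratioTerm (k l m : ℕ) {P Q : ℝ → ℂ} {a b w : ℂ} {y : ℝ}
    (hP : HasDerivAt P (a * P y) y) (hQ : HasDerivAt Q (b * Q y) y) (hw : P y + Q y - w ≠ 0) :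
    HasDerivAt (fun y => ratioTerm k l m (P y) (Q y) w)
      ((k * a + l * b) * ratioTerm k l m (P y) (Q y) w
        - m * a * ratioTerm (k + 1) l (m + 1) (P y) (Q y) w
        - m * b * ratioTerm k (l + 1) (m + 1) (P y) (Q y) w) y := by
  have hpow : ∀ (n : ℕ) (c d : ℂ), (n : ℂ) * c ^ (n - 1) * (d * c) = n * d * c ^ n := by
    intro n c d
    cases n with
    | zero => simp
    | succ n => simp only [Nat.add_sub_cancel]; ring
  have h1 := (hP.fun_pow k).mul (hQ.fun_pow l)
  have h2 := (((hP.add hQ).sub_const w).fun_pow m).fun_inv (pow_ne_zero m hw)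
  convert! h1.mul h2 using 1
  rw [hpow, hpow]
  have h3 : (m : ℂ) * (P y + Q y - w) ^ (m - 1) * (P y + Q y - w) = m * (P y + Q y - w) ^ m := by
    cases m with
    | zero => simp
    | succ m => simp only [Nat.add_sub_cancel]; ring
  have h4 : -(↑m * (P y + Q y - w) ^ (m - 1) * (a * P y + b * Q y)) /
      ((P y + Q y - w) ^ m) ^ 2 =
      -(m * (a * P y + b * Q y)) * ((P y + Q y - w) ^ (m + 1))⁻¹ := by
    rw [div_eq_iff (pow_ne_zero _ (pow_ne_zero _ hw))]
    apply mul_right_cancel₀ hw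
    have h5 : ((P y + Q y - w) ^ (m + 1))⁻¹ * ((P y + Q y - w) ^ m) ^ 2 * (P y + Q y - w)
        = (P y + Q y - w) ^ m := by
      have := pow_ne_zero m hw
      rw [pow_succ]
      field_simp
    linear_combination (-(a * P y + b * Q y)) * h3 + (m * (a * P y + b * Q y)) * h5
  simp only [Pi.add_apply, Pi.mul_apply] at *
  rw [h4]
  simp only [ratioTerm]
  ring

/-- The `k + l` numerator factors are each compensated by one factor of the denominator; as `k + l <
m`, at least one denominator factor is left to supply `E⁻¹`, and any others are harmless because `1
≤ B * ‖p + q - w‖`. -/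
theorem norm_ratioTerm_le {k l m : ℕ} (h : k + l < m) {p q w : ℂ} {B E : ℝ} (hE : 1 ≤ E)
    (hp : ‖p‖ ≤ B * ‖p + q - w‖) (hq : ‖q‖ ≤ B * ‖p + q - w‖) (hB : E ≤ B * ‖p + q - w‖) :
    ‖ratioTerm k l m p q w‖ ≤ B ^ m * E⁻¹ := by
  set N := ‖p + q - w‖
  have hBN : 0 < B * N := by linarith
  have hN : 0 < N := lt_of_le_of_ne (norm_nonneg _) fun h => by simp [← h] at hBN
  have hB0 : 0 < B := pos_of_mul_pos_left hBN hN.le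
  obtain ⟨d, rfl⟩ := Nat.exists_eq_add_of_lt h
  rw [ratioTerm, norm_mul, norm_mul, norm_pow, norm_pow, norm_inv, norm_pow, ← div_eq_mul_inv,
    ← div_eq_mul_inv, div_le_div_iff₀ (pow_pos hN _) (by linarith), ← mul_pow]
  calc ‖p‖ ^ k * ‖q‖ ^ l * E ≤ (B * N) ^ k * (B * N) ^ l * (B * N) := by gcongr
    _ = (B * N) ^ (k + l + 1) := by ring
    _ ≤ (B * N) ^ (k + l + d + 1) := pow_le_pow_right₀ (hE.trans hB) (by omega)

omit [Fintype ι] in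
-- The hypothesis `hB` is the only analytic input: a locally uniform lower bound for the denominator
-- by `P`, by `Q` and by `e^{ℓ/2}`.
theorem derivClass_ratioTerm {U : Set V} {P Q : (ι → ℝ) → ℂ} {w : V → ℂ} {ℓ : (ι → ℝ) → ℝ}
    {a b : ι → ℂ} (hPc : ContinuousOn P (octant ι)) (hQc : ContinuousOn Q (octant ι))
    (hP : ∀ x ∈ octant ι, ∀ j, HasDerivAt (fun y => P (Function.update x j y)) (a j * P x) (x j))
    (hQ : ∀ x ∈ octant ι, ∀ j, HasDerivAt (fun y => Q (Function.update x j y)) (b j * Q x) (x j))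
    (hw : DifferentiableOn ℂ w U) (hℓ : ∀ x ∈ octant ι, 0 ≤ ℓ x)
    (hB : ∀ z₀ ∈ U, ∃ B, ∀ᶠ z in 𝓝 z₀, ∀ x ∈ octant ι, ‖P x‖ ≤ B * ‖P x + Q x - w z‖ ∧
      ‖Q x‖ ≤ B * ‖P x + Q x - w z‖ ∧ Real.exp (ℓ x / 2) ≤ B * ‖P x + Q x - w z‖) :
    DerivClass U ℓ {F | ∃ k l m, k + l < m ∧ F = fun z x => ratioTerm k l m (P x) (Q x) (w z)} := by
  have hne : ∀ z ∈ U, ∀ x ∈ octant ι, P x + Q x - w z ≠ 0 := by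
    intro z hz x hx h0
    obtain ⟨B, hB⟩ := hB z hz
    have := (hB.self_of_nhds x hx).2.2
    rw [h0, norm_zero, mul_zero] at this
    exact (Real.exp_pos _).not_ge this
  constructor
  · rintro _ ⟨k, l, m, -, rfl⟩ z hz
    exact ((hPc.pow k).mul (hQc.pow l)).mul
      ((((hPc.add hQc).sub continuousOn_const).pow m).inv₀ fun x hx => pow_ne_zero m (hne z hz x hx))
  · rintro _ ⟨k, l, m, -, rfl⟩ x hx
    exact ((((differentiableOn_const _).sub hw).pow m).inv
      fun z hz => pow_ne_zero m (hne z hz x hx)).const_mul _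
  · rintro _ ⟨k, l, m, hm, rfl⟩ z₀ hz
    obtain ⟨B, hB⟩ := hB z₀ hz
    refine ⟨B ^ m, hB.mono fun z hz x hx => ?_⟩
    obtain ⟨h1, h2, h3⟩ := hz x hx
    rw [neg_div, Real.exp_neg]
    exact norm_ratioTerm_le hm (Real.one_le_exp (by linarith [hℓ x hx])) h1 h2 h3
  · rintro _ ⟨k, l, m, hm, rfl⟩ j
    let f (k l m : ℕ) : V → (ι → ℝ) → ℂ := fun z x => ratioTerm k l m (P x) (Q x) (w z)
    refine ⟨-((k * a j + l * b j) • f k l m - (m * a j) • f (k + 1) l (m + 1)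
      - (m * b j) • f k (l + 1) (m + 1)), ?_, fun z hz x hx => ?_⟩
    · refine neg_mem (sub_mem (sub_mem ?_ ?_) ?_) <;>
        refine Submodule.smul_mem _ _ (Submodule.subset_span ⟨_, _, _, ?_, rfl⟩) <;> omega
    · have := hasDerivAt_ratioTerm k l m (y := x j) (w := w z) (a := a j) (b := b j)
        (P := fun y => P (Function.update x j y)) (Q := fun y => Q (Function.update x j y))
        (by simpa using hP x hx j) (by simpa using hQ x hx j) (by simpa using hne z hz x hx)
      simpa [f] using this

end DerivClass

/-! ### The polylogarithm kernel and the symmetric kernel -/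

/-- The partial sum `x_i + ... + x_r`. -/
def suffixSum {r : ℕ} (x : Fin r → ℝ) (i : Fin r) : ℝ := ∑ j ∈ Finset.Ici i, x j

/-- The kernel `∏ 1 / (e^{x_i + ... + x_r} - z_i)` of the integral representation of multiple
polylogarithms. -/
noncomputable def polylogKernel {r : ℕ} (z : Fin r → ℂ) (x : Fin r → ℝ) : ℂ :=
  ∏ i, (Complex.exp (suffixSum x i : ℝ) - z i)⁻¹

/-- The symmetric kernel `∏ 1 / (e^{x_i + ... + x_r} + e^{t_i + ... + t_r} - 1)`. -/
noncomputable def etaKernel {r : ℕ} (x : Fin r ⊕ Fin r → ℝ) : ℂ :=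
  ∏ i, (Complex.exp (suffixSum (x ∘ Sum.inl) i : ℝ) +
    Complex.exp (suffixSum (x ∘ Sum.inr) i : ℝ) - 1)⁻¹

theorem sum_le_sum_suffixSum {r : ℕ} {x : Fin r → ℝ} (hx : ∀ j, 0 < x j) :
    ∑ j, x j ≤ ∑ i, suffixSum x i :=
  Finset.sum_le_sum fun _ _ =>
    Finset.single_le_sum (fun j _ => (hx j).le) (Finset.mem_Ici.2 le_rfl)

theorem suffixSum_pos {r : ℕ} {x : Fin r → ℝ} (hx : ∀ j, 0 < x j) (i : Fin r) :
    0 < suffixSum x i :=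
  Finset.sum_pos (fun j _ => hx j) ⟨i, Finset.mem_Ici.2 le_rfl⟩

theorem hasDerivAt_exp_sum_update {ι : Type*} [DecidableEq ι] (S : Finset ι)
    (x : ι → ℝ) (j : ι) :
    HasDerivAt (fun y => Complex.exp ((∑ k ∈ S, Function.update x j y k : ℝ) : ℂ))
      ((if j ∈ S then 1 else 0) * Complex.exp ((∑ k ∈ S, x k : ℝ) : ℂ)) (x j) := by
  have h1 : HasDerivAt (fun y => ∑ k ∈ S, Function.update x j y k) (∑ k ∈ S, if k = j then 1 else 0)
      (x j) := by
    refine HasDerivAt.fun_sum fun k _ => ?_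
    rcases eq_or_ne k j with rfl | h
    · simpa using hasDerivAt_id' (x k)
    · simpa [h] using hasDerivAt_const (x j) (x k)
  have h2 := h1.ofReal_comp.cexp
  simp only [Function.update_eq_self] at h2
  convert! h2 using 1
  split_ifs <;> simp_all [mul_comm]

theorem isOpen_slitRegion : IsOpen {w : ℂ | ∀ x : ℝ, 1 ≤ x → w ≠ (x : ℂ)} := by
  have h : {w : ℂ | ∀ x : ℝ, 1 ≤ x → w ≠ (x : ℂ)} = ((fun x : ℝ => (x : ℂ)) '' Set.Ici 1)ᶜ := by
    ext w
    simp only [Set.mem_ofPred_eq, Set.mem_compl_iff, Set.mem_image, Set.mem_Ici, not_exists,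
      not_and]
    exact forall_congr' fun x => forall_congr' fun _ => ne_comm
  rw [h]
  exact (Complex.isometry_ofReal.isClosedEmbedding.isClosedMap _ isClosed_Ici).isOpen_compl

theorem isOpen_cutRegion (r : ℕ) : IsOpen (cutRegion r) := by
  have h : cutRegion r =
      ⋂ j, (fun z : Fin r → ℂ => z j) ⁻¹' {w : ℂ | ∀ x : ℝ, 1 ≤ x → w ≠ (x : ℂ)} := by
    ext z; simp [cutRegion]
  rw [h]
  exact isOpen_iInter_of_finite fun j => isOpen_slitRegion.preimage (continuous_apply j)

/-- Away from the cut, `|e^X - w|` is bounded below by a multiple of `e^X`, locally uniformly. -/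
theorem exists_exp_le_mul_norm_sub {w₀ : ℂ} (hw : ∀ x : ℝ, 1 ≤ x → w₀ ≠ (x : ℂ)) :
    ∃ B, ∀ᶠ w in 𝓝 w₀, ∀ X : ℝ, 0 ≤ X → Real.exp X ≤ B * ‖Complex.exp X - w‖ := by
  obtain ⟨K, hK, hKw, hKc⟩ := exists_compact_subset isOpen_slitRegion hw
  -- After division by `e^X`, put `u = e^{-X} ∈ [0, 1]`. Then `|1 - u w|` has a positive minimum on
  -- a compact set, since `u w = 1` would give `w = 1 / u ≥ 1`, a point of the cut.
  have hc : ContinuousOn (fun p : ℝ × ℂ => ‖1 - p.1 * p.2‖) (Icc (0 : ℝ) 1 ×ˢ K) := by fun_prop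
  obtain ⟨p, hp, hmin⟩ := (isCompact_Icc.prod hK).exists_isMinOn
    ⟨(0, w₀), ⟨by simp, interior_subset hKw⟩⟩ hc
  have hpos : 0 < ‖1 - (p.1 : ℂ) * p.2‖ := by
    refine norm_pos_iff.2 fun h => ?_
    have h0 : p.1 ≠ 0 := by
      intro h0; simp [h0] at h
    have hp0 : 0 < p.1 := lt_of_le_of_ne hp.1.1 h0.symm
    refine hKc hp.2 p.1⁻¹ ((one_le_inv₀ hp0).2 hp.1.2) ?_
    rw [Complex.ofReal_inv]
    exact (inv_eq_of_mul_eq_one_right (sub_eq_zero.1 h).symm).symm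
  refine ⟨‖1 - (p.1 : ℂ) * p.2‖⁻¹, ?_⟩
  filter_upwards [mem_interior_iff_mem_nhds.1 hKw] with w hwK X hX
  have h1 := hmin (a := (Real.exp (-X), w))
    ⟨⟨(Real.exp_pos _).le, Real.exp_le_one_iff.2 (by linarith)⟩, hwK⟩
  have h2 : Real.exp X * ‖1 - (Real.exp (-X) : ℂ) * w‖ = ‖Complex.exp X - w‖ := by
    rw [← abs_of_pos (Real.exp_pos X), ← Real.norm_eq_abs, ← Complex.norm_real, ← norm_mul,
      Complex.ofReal_exp, mul_sub, ← mul_assoc]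
    simp [← Complex.exp_add]
  rw [← div_eq_inv_mul, le_div_iff₀ hpos, ← h2]
  exact mul_le_mul_of_nonneg_left h1 (Real.exp_pos X).le

/-- Each factor is a `ratioTerm 0 0 1` with `P = e^{X_i}` and `Q = 0`; the decay rates `X_i` add up
to at least `∑ x_j`. -/
theorem smoothDecayFamily_polylogKernel (r : ℕ) :
    SmoothDecayFamily (cutRegion r) (polylogKernel (r := r)) := by
  have h : ∀ i : Fin r, DerivClass (cutRegion r) (fun x : Fin r → ℝ => suffixSum x i)
      {F | ∃ k l m, k + l < m ∧ F = fun z x => ratioTerm k l m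
        (Complex.exp (suffixSum x i : ℝ)) 0 (z i)} := by
    intro i
    refine derivClass_ratioTerm (P := fun x => Complex.exp (suffixSum x i : ℝ))
      (a := fun j => if j ∈ Finset.Ici i then 1 else 0) (b := 0) ?_ continuousOn_const
      (fun x _ j => hasDerivAt_exp_sum_update _ x j)
      (fun x _ j => by simpa using hasDerivAt_const (x j) (0 : ℂ)) (by fun_prop)
      (fun x hx => (suffixSum_pos hx i).le) fun z₀ hz => ?_
    · unfold suffixSum
      fun_prop
    · obtain ⟨B, hB⟩ := exists_exp_le_mul_norm_sub (hz i)
      refine ⟨B, ((continuous_apply i).tendsto z₀ |>.eventually hB).mono fun z hz x hx => ?_⟩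
      have hX := suffixSum_pos hx i
      have h1 := hz _ hX.le
      simp only [add_zero, Complex.norm_exp, Complex.ofReal_re, norm_zero]
      exact ⟨h1, (Real.exp_pos _).le.trans h1,
        (Real.exp_le_exp.2 (by linarith)).trans h1⟩
  refine (DerivClass.prod h).smoothDecayFamily (isOpen_cutRegion r)
    (fun x hx => sum_le_sum_suffixSum hx)
    ⟨fun i z x => ratioTerm 0 0 1 (Complex.exp (suffixSum x i : ℝ)) 0 (z i),
      fun i => Submodule.subset_span ⟨0, 0, 1, one_pos, rfl⟩, ?_⟩
  ext z x
  simp [polylogKernel, ratioTerm]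

theorem suffixSum_comp_inl {r : ℕ} (x : Fin r ⊕ Fin r → ℝ) (i : Fin r) :
    suffixSum (x ∘ Sum.inl) i = ∑ j ∈ (Finset.Ici i).disjSum ∅, x j := by
  simp [suffixSum]

theorem suffixSum_comp_inr {r : ℕ} (x : Fin r ⊕ Fin r → ℝ) (i : Fin r) :
    suffixSum (x ∘ Sum.inr) i = ∑ j ∈ Finset.disjSum ∅ (Finset.Ici i), x j := by
  simp [suffixSum]

/-- The kernel has no parameter; the space `ℂ` is a dummy that makes the results on families
applicable. -/
theorem smoothDecayFamily_etaKernel (r : ℕ) :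
    SmoothDecayFamily (Set.univ : Set ℂ) fun _ => etaKernel (r := r) := by
  have h : ∀ i : Fin r, DerivClass (Set.univ : Set ℂ)
      (fun x : Fin r ⊕ Fin r → ℝ => suffixSum (x ∘ Sum.inl) i + suffixSum (x ∘ Sum.inr) i)
      {F | ∃ k l m, k + l < m ∧ F = fun z x => ratioTerm k l m
        (Complex.exp (suffixSum (x ∘ Sum.inl) i : ℝ))
        (Complex.exp (suffixSum (x ∘ Sum.inr) i : ℝ)) ((fun _ => 1) z)} := by
    intro i
    refine derivClass_ratioTerm (P := fun x => Complex.exp (suffixSum (x ∘ Sum.inl) i : ℝ))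
      (Q := fun x => Complex.exp (suffixSum (x ∘ Sum.inr) i : ℝ)) (w := fun _ => 1)
      (a := fun j => if j ∈ (Finset.Ici i).disjSum ∅ then 1 else 0)
      (b := fun j => if j ∈ Finset.disjSum ∅ (Finset.Ici i) then 1 else 0) ?_ ?_
      (fun x _ j => ?_) (fun x _ j => ?_) (by fun_prop) (fun x hx => ?_) fun z₀ hz => ?_
    · unfold suffixSum
      fun_prop
    · unfold suffixSum
      fun_prop
    · simp only [suffixSum_comp_inl]
      exact hasDerivAt_exp_sum_update _ x j
    · simp only [suffixSum_comp_inr]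
      exact hasDerivAt_exp_sum_update _ x j
    · exact add_nonneg (suffixSum_pos (fun j => hx (Sum.inl j)) i).le
        (suffixSum_pos (fun j => hx (Sum.inr j)) i).le
    · refine ⟨1, Eventually.of_forall fun z x hx => ?_⟩
      have hX := suffixSum_pos (x := x ∘ Sum.inl) (fun j => hx (Sum.inl j)) i
      have hT := suffixSum_pos (x := x ∘ Sum.inr) (fun j => hx (Sum.inr j)) i
      set X := suffixSum (x ∘ Sum.inl) i
      set T := suffixSum (x ∘ Sum.inr) i
      have h1 := Real.one_le_exp hX.le
      have h2 := Real.one_le_exp hT.le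
      have h3 : ‖Complex.exp X + Complex.exp T - 1‖ = Real.exp X + Real.exp T - 1 := by
        rw [← Complex.ofReal_exp, ← Complex.ofReal_exp, ← Complex.ofReal_one,
          ← Complex.ofReal_add, ← Complex.ofReal_sub, Complex.norm_real, Real.norm_eq_abs,
          abs_of_nonneg (by linarith)]
      simp only [Complex.norm_exp, Complex.ofReal_re, one_mul, h3]
      refine ⟨by linarith, by linarith, ?_⟩
      -- Here `e^{(X+T)/2} ≤ max (e^X, e^T) ≤ e^X + e^T - 1`. This inequality explains the rate `1 /
      -- 2` in the decay conditions.
      rcases le_total X T with h | h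
      · have := Real.exp_le_exp.2 (show (X + T) / 2 ≤ T by linarith)
        linarith
      · have := Real.exp_le_exp.2 (show (X + T) / 2 ≤ X by linarith)
        linarith
  refine (DerivClass.prod h).smoothDecayFamily isOpen_univ (fun x hx => ?_)
    ⟨fun i z x => ratioTerm 0 0 1 (Complex.exp (suffixSum (x ∘ Sum.inl) i : ℝ))
        (Complex.exp (suffixSum (x ∘ Sum.inr) i : ℝ)) ((fun _ => 1) z),
      fun i => Submodule.subset_span ⟨0, 0, 1, one_pos, rfl⟩, ?_⟩
  · rw [Fintype.sum_sum_type, Finset.sum_add_distrib]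
    exact add_le_add (sum_le_sum_suffixSum fun j => hx (Sum.inl j))
      (sum_le_sum_suffixSum fun j => hx (Sum.inr j))
  · ext z x
    simp [etaKernel, ratioTerm]

/-! ### The multiple polylogarithm series indexed by gaps -/

/-- A product of absolutely convergent series, expanded over multi-indices. -/
theorem summable_norm_and_hasSum_prod_pi {r : ℕ} (f : Fin r → ℕ → ℂ)
    (hf : ∀ i, Summable fun n => ‖f i n‖) :
    Summable (fun m : Fin r → ℕ => ‖∏ i, f i (m i)‖) ∧
      HasSum (fun m : Fin r → ℕ => ∏ i, f i (m i)) (∏ i, ∑' n, f i n) := by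
  induction r with
  | zero =>
    refine ⟨(hasSum_fintype _).summable, ?_⟩
    convert! hasSum_fintype fun _ : Fin 0 → ℕ => (1 : ℂ) using 1
    simp
  | succ r ih =>
    obtain ⟨h1, h2⟩ := ih (fun i => f i.succ) fun i => hf i.succ
    obtain ⟨g, hg⟩ : ∃ g : (Fin r → ℕ) → ℂ, g = fun q => ∏ i, f i.succ (q i) := ⟨_, rfl⟩
    rw [← hg] at h2
    replace h1 : Summable fun q => ‖g q‖ := by rw [hg]; exact h1
    have h3 : Summable fun p : ℕ × (Fin r → ℕ) => ‖f 0 p.1 * g p.2‖ :=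
      Summable.mul_norm (hf 0) h1
    let e := Fin.consEquiv (fun _ : Fin (r + 1) => ℕ)
    have he : ∀ p : ℕ × (Fin r → ℕ), ∏ i, f i (e p i) = f 0 p.1 * g p.2 := by
      intro p
      simp [e, hg, Fin.prod_univ_succ, Fin.consEquiv]
    rw [← e.summable_iff, ← e.hasSum_iff, Fin.prod_univ_succ]
    simp only [Function.comp_def, he]
    exact ⟨h3, HasSum.mul (hf 0).of_norm.hasSum h2 h3.of_norm⟩

/-- The tuple `0 < n_1 < ... < n_r` with gaps `m_j + 1`. -/
def tupleOfGaps {r : ℕ} (m : Fin r → ℕ) : PosStrictTuple r :=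
  ⟨fun j => ∑ i ∈ Finset.Iic j, (m i + 1),
    fun _ b hab => Finset.sum_lt_sum_of_subset (Finset.Iic_subset_Iic.2 hab.le)
      (i := b) (by simp) (by simpa using hab) (Nat.succ_pos _) fun _ _ _ => Nat.zero_le _,
    fun j => Finset.sum_pos (fun _ _ => Nat.succ_pos _) ⟨j, by simp⟩⟩

theorem sum_Iic_eq_add {r : ℕ} (a : Fin r → ℕ) (j : Fin r) :
    ∑ i ∈ Finset.Iic j, a i = a j + (if (j : ℕ) = 0 then 0 else
      ∑ i ∈ Finset.Iic (⟨(j : ℕ) - 1, lt_of_le_of_lt (Nat.sub_le _ _) j.isLt⟩ : Fin r), a i) := by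
  split_ifs with h
  · have : Finset.Iic j = {j} := by
      ext i; simp only [Finset.mem_Iic, Finset.mem_singleton, Fin.le_def, Fin.ext_iff]; omega
    simp [this]
  · rw [← Finset.sum_insert (by simp only [Finset.mem_Iic, Fin.le_def]; omega)]
    congr 1
    ext i; simp only [Finset.mem_Iic, Finset.mem_insert, Fin.le_def, Fin.ext_iff]; omega

theorem indexGap_tupleOfGaps {r : ℕ} (m : Fin r → ℕ) (j : Fin r) :
    indexGap (tupleOfGaps m).1 j = m j + 1 := by
  have := sum_Iic_eq_add (fun i => m i + 1) j
  simp only [indexGap, tupleOfGaps]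
  omega

theorem sum_Iic_indexGap {r : ℕ} {n : Fin r → ℕ} (hn : StrictMono n) (j : Fin r) :
    ∑ i ∈ Finset.Iic j, indexGap n i = n j := by
  obtain ⟨k, hk⟩ := j
  induction k with
  | zero => rw [sum_Iic_eq_add]; simp [indexGap]
  | succ k ih =>
    have ih' := ih (by omega)
    rw [sum_Iic_eq_add, if_neg (Nat.succ_ne_zero k)]
    simp only [Nat.add_sub_cancel]
    rw [ih']
    simp only [indexGap, Nat.succ_ne_zero, if_false, Nat.add_sub_cancel]
    have : n ⟨k, by omega⟩ < n ⟨k + 1, hk⟩ := hn (by simp [Fin.lt_def])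
    omega

theorem indexGap_pos {r : ℕ} (n : PosStrictTuple r) (j : Fin r) : 0 < indexGap n.1 j := by
  have h0 := n.2.2 j
  rw [indexGap]
  split_ifs with h
  · exact h0
  · exact Nat.sub_pos_of_lt (n.2.1 (by simp only [Fin.lt_def]; omega))

theorem bijective_tupleOfGaps (r : ℕ) : Function.Bijective (tupleOfGaps (r := r)) := by
  constructor
  · intro m m' h
    ext j
    have h1 := indexGap_tupleOfGaps m j
    rw [h, indexGap_tupleOfGaps] at h1
    omega
  · intro n
    refine ⟨fun j => indexGap n.1 j - 1, Subtype.ext (funext fun j => ?_)⟩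
    rw [← sum_Iic_indexGap n.2.1 j]
    exact Finset.sum_congr rfl fun i _ => Nat.sub_add_cancel (indexGap_pos n i)

/-- A bound in product form lets the powers of `n_j` be distributed over the gaps, so that the
majorant factors into one-variable series. -/
theorem tupleOfGaps_le_prod {r : ℕ} (m : Fin r → ℕ) (j : Fin r) :
    (tupleOfGaps m).1 j ≤ ∏ i, (m i + 2) := by
  have h : ∀ S : Finset (Fin r), ∑ i ∈ S, (m i + 1) + 1 ≤ ∏ i ∈ S, (m i + 2) := by
    intro S
    induction S using Finset.induction_on with
    | empty => simp
    | insert i S hi ih =>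
      rw [Finset.sum_insert hi, Finset.prod_insert hi]
      have h1 : 1 ≤ ∏ k ∈ S, (m k + 2) := (Nat.le_add_left _ _).trans ih
      nlinarith [Nat.mul_le_mul_left (m i + 1) h1]
  exact ((Nat.le_succ _).trans (h _)).trans
    (Finset.prod_le_prod_of_subset_of_one_le' (Finset.subset_univ _) fun i _ _ => by omega)

/-- Summation by parts: each gap is paired with the suffix sum of `x`, so `exp (-∑ n_j x_j)` factors
over the gaps. -/
theorem sum_tupleOfGaps_mul {r : ℕ} (m : Fin r → ℕ) (x : Fin r → ℝ) :
    ∑ j, ((tupleOfGaps m).1 j : ℝ) * x j = ∑ i, (m i + 1 : ℝ) * suffixSum x i := by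
  simp only [tupleOfGaps, suffixSum, Finset.mul_sum, Nat.cast_sum, Finset.sum_mul, Nat.cast_add,
    Nat.cast_one]
  exact Finset.sum_comm' fun i j => by simp

theorem summable_add_two_pow_mul_geometric (k : ℕ) {ρ : ℝ} (h0 : 0 ≤ ρ) (h1 : ρ < 1) :
    Summable fun n : ℕ => ((n : ℝ) + 2) ^ k * ρ ^ (n + 1) := by
  have h := summable_pow_mul_geometric_of_norm_lt_one k
    (show ‖ρ‖ < 1 by rwa [Real.norm_eq_abs, abs_of_nonneg h0])
  have h' : Summable fun n : ℕ => ((n + 1 : ℕ) : ℝ) ^ k * ρ ^ (n + 1) :=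
    (summable_nat_add_iff (f := fun n : ℕ => (n : ℝ) ^ k * ρ ^ n) 1).2 h
  refine Summable.of_nonneg_of_le (fun n => by positivity) (fun n => ?_) (h'.mul_left (2 ^ k))
  rw [← mul_assoc, ← mul_pow]
  have : (n : ℝ) + 2 ≤ 2 * ((n + 1 : ℕ) : ℝ) := by push_cast; linarith [Nat.cast_nonneg (α := ℝ) n]
  gcongr

theorem multiPolylogTerm_tupleOfGaps {r : ℕ} (s z : Fin r → ℂ) (m : Fin r → ℕ) :
    multiPolylogTerm s z (tupleOfGaps m) =
      (∏ i, z i ^ (m i + 1)) * ∏ j, ((tupleOfGaps m).1 j : ℂ) ^ (-s j) := by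
  simp only [multiPolylogTerm, indexGap_tupleOfGaps, Complex.cpow_neg, div_eq_mul_inv,
    Finset.prod_mul_distrib]

/-- A summable majorant of the series, uniform for bounded exponents. -/
theorem norm_multiPolylogTerm_le {r : ℕ} {s z : Fin r → ℂ} {A : ℕ} (hs : ∀ j, ‖s j‖ ≤ A)
    (m : Fin r → ℕ) :
    ‖multiPolylogTerm s z (tupleOfGaps m)‖ ≤
      ∏ i, (((m i : ℝ) + 2) ^ (A * r) * ‖z i‖ ^ (m i + 1)) := by
  rw [multiPolylogTerm_tupleOfGaps, norm_mul, norm_prod, norm_prod, Finset.prod_mul_distrib,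
    mul_comm]
  simp only [norm_pow]
  refine mul_le_mul_of_nonneg_right ?_ (Finset.prod_nonneg fun _ _ => by positivity)
  have h : ∀ j, ‖((tupleOfGaps m).1 j : ℂ) ^ (-s j)‖ ≤ (∏ i, ((m i : ℝ) + 2)) ^ A := by
    intro j
    have hpos : 0 < (tupleOfGaps m).1 j := (tupleOfGaps m).2.2 j
    have h1 : (1 : ℝ) ≤ (tupleOfGaps m).1 j := by exact_mod_cast hpos
    rw [Complex.norm_natCast_cpow_of_pos hpos]
    calc ((tupleOfGaps m).1 j : ℝ) ^ (-s j).re ≤ ((tupleOfGaps m).1 j : ℝ) ^ (A : ℝ) := by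
          refine Real.rpow_le_rpow_of_exponent_le h1 ?_
          have := Complex.re_le_norm (-s j)
          rw [norm_neg] at this
          exact this.trans (hs j)
      _ = ((tupleOfGaps m).1 j : ℝ) ^ A := Real.rpow_natCast _ _
      _ ≤ _ := pow_le_pow_left₀ (by positivity) (by exact_mod_cast tupleOfGaps_le_prod m j) _
  -- Each of the `r` factors contributes the exponent `A`, whence `A * r`.
  calc _ ≤ ∏ _j : Fin r, (∏ i, ((m i : ℝ) + 2)) ^ A :=
        Finset.prod_le_prod (fun _ _ => norm_nonneg _) fun j _ => h j
    _ = _ := by simp [← pow_mul, Finset.prod_pow]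

theorem summable_majorant {r : ℕ} {z : Fin r → ℂ} (hz : ∀ j, ‖z j‖ < 1) (k : ℕ) :
    Summable fun m : Fin r → ℕ => ∏ i, (((m i : ℝ) + 2) ^ k * ‖z i‖ ^ (m i + 1)) := by
  have := (summable_norm_and_hasSum_prod_pi
    (fun i n => ((((n : ℝ) + 2) ^ k * ‖z i‖ ^ (n + 1) : ℝ) : ℂ)) fun i => ?_).1
  · refine this.congr fun m => ?_
    rw [← Complex.ofReal_prod, Complex.norm_real, Real.norm_eq_abs,
      abs_of_nonneg (Finset.prod_nonneg fun _ _ => by positivity)]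
  · refine (summable_add_two_pow_mul_geometric k (norm_nonneg (z i)) (hz i)).congr fun n => ?_
    rw [Complex.norm_real, Real.norm_eq_abs, abs_of_nonneg (by positivity)]

theorem summable_norm_multiPolylogTerm {r : ℕ} (s : Fin r → ℂ) {z : Fin r → ℂ}
    (hz : ∀ j, ‖z j‖ < 1) :
    Summable fun m : Fin r → ℕ => ‖multiPolylogTerm s z (tupleOfGaps m)‖ := by
  obtain ⟨A, hA⟩ := exists_nat_ge ‖s‖
  exact .of_nonneg_of_le (fun _ => norm_nonneg _)
    (norm_multiPolylogTerm_le fun j => (norm_le_pi_norm s j).trans hA) (summable_majorant hz (A * r))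

/-- The multiple polylogarithm series is entire in its exponents. -/
theorem differentiable_tsum_multiPolylogTerm {r : ℕ} {z : Fin r → ℂ} (hz : ∀ j, ‖z j‖ < 1) :
    Differentiable ℂ fun s : Fin r → ℂ =>
      ∑' m : Fin r → ℕ, multiPolylogTerm s z (tupleOfGaps m) := by
  intro s₀
  -- The sum is read as an integral for the counting measure, so that the theorem on dominated
  -- holomorphic families applies.
  have heq : (fun s : Fin r → ℂ => ∑' m : Fin r → ℕ, multiPolylogTerm s z (tupleOfGaps m)) =
      fun s => ∫ m : Fin r → ℕ, multiPolylogTerm s z (tupleOfGaps m) ∂Measure.count := by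
    ext s
    rw [integral_countable (integrable_count_iff.2 (summable_norm_multiPolylogTerm s hz))]
    simp [Measure.real]
  rw [heq]
  obtain ⟨A, hA⟩ := exists_nat_ge (‖s₀‖ + 1)
  refine differentiableAt_integral_of_dominated one_pos
    (bound := fun m => ∏ i, (((m i : ℝ) + 2) ^ (A * r) * ‖z i‖ ^ (m i + 1)))
    (fun s _ => (measurable_of_countable _).aestronglyMeasurable)
    (Eventually.of_forall fun m s hs => norm_multiPolylogTerm_le (fun j => ?_) m)
    (integrable_count_iff.2 (summable_majorant hz (A * r)).norm)
    (Eventually.of_forall fun m => ?_)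
  · refine (norm_le_pi_norm s j).trans (le_trans ?_ hA)
    have := mem_ball_iff_norm.1 hs
    linarith [norm_sub_norm_le s s₀]
  · simp only [multiPolylogTerm_tupleOfGaps]
    refine DifferentiableOn.const_mul (differentiableOn_fun_prod fun j => ?_) _
    refine DifferentiableOn.const_cpow (by fun_prop) (Or.inl ?_)
    exact_mod_cast ((tupleOfGaps m).2.2 j).ne'

/-! ### Integral representation of the multiple polylogarithm -/

theorem tsum_geometric_kernel {w : ℂ} (hw : ‖w‖ < 1) {X : ℝ} (hX : 0 ≤ X) :
    (Summable fun n : ℕ => ‖w ^ (n + 1) * Complex.exp (-((n + 1) * X : ℝ))‖) ∧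
      ∑' n : ℕ, w ^ (n + 1) * Complex.exp (-((n + 1) * X : ℝ)) =
        w * (Complex.exp X - w)⁻¹ := by
  have h1 : ∀ n : ℕ, w ^ (n + 1) * Complex.exp (-((n + 1) * X : ℝ)) =
      (w * Complex.exp (-X)) * (w * Complex.exp (-X)) ^ n := by
    intro n
    rw [← pow_succ', mul_pow, ← Complex.exp_nat_mul]
    push_cast
    ring_nf
  have h2 : ‖w * Complex.exp (-X)‖ < 1 := by
    rw [norm_mul, Complex.norm_exp]
    have : Real.exp (-(X : ℂ)).re ≤ 1 := by simpa using hX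
    exact (mul_le_of_le_one_right (norm_nonneg _) this).trans_lt hw
  simp only [h1]
  refine ⟨(summable_geometric_of_norm_lt_one h2).norm.mul_left ‖w * Complex.exp (-X)‖ |>.congr
    fun n => (norm_mul _ _).symm, ?_⟩
  rw [tsum_mul_left, tsum_geometric_of_norm_lt_one h2]
  have h3 : Complex.exp X ≠ 0 := Complex.exp_ne_zero _
  have h4 : 1 - w * Complex.exp (-X) ≠ 0 := by
    intro h
    rw [← sub_eq_zero.1 h, norm_one] at h2
    exact h2.false
  rw [Complex.exp_neg] at h4 ⊢
  have h5 : Complex.exp X - w ≠ 0 := by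
    intro h
    apply h4
    rw [← sub_eq_zero.1 h, mul_inv_cancel₀ h3, sub_self]
  field_simp

theorem hasSum_polylogKernel {r : ℕ} {z : Fin r → ℂ} (hz : ∀ j, ‖z j‖ < 1) {x : Fin r → ℝ}
    (hx : x ∈ octant (Fin r)) :
    HasSum (fun m : Fin r → ℕ => (∏ i, z i ^ (m i + 1)) *
      Complex.exp (-(∑ j, ((tupleOfGaps m).1 j : ℝ) * x j : ℝ)))
      ((∏ i, z i) * polylogKernel z x) := by
  have h := (summable_norm_and_hasSum_prod_pi
    (fun i n => z i ^ (n + 1) * Complex.exp (-((n + 1) * suffixSum x i : ℝ)))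
    fun i => (tsum_geometric_kernel (hz i) (suffixSum_pos hx i).le).1).2
  have h' : ∀ i, ∑' n : ℕ, z i ^ (n + 1) * Complex.exp (-((n + 1) * suffixSum x i : ℝ)) =
      z i * (Complex.exp (suffixSum x i : ℝ) - z i)⁻¹ :=
    fun i => (tsum_geometric_kernel (hz i) (suffixSum_pos hx i).le).2
  simp only [h', Finset.prod_mul_distrib, ← Complex.exp_sum] at h
  convert! h using 4 with m
  rw [sum_tupleOfGaps_mul]
  push_cast
  rw [Finset.sum_neg_distrib]

theorem integral_cpow_mul_exp_neg_sum {r : ℕ} {s : Fin r → ℂ} (hs : ∀ j, 0 < (s j).re)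
    {n : Fin r → ℕ} (hn : ∀ j, 0 < n j) :
    ∫ x in octant (Fin r), Complex.exp (-(∑ j, (n j : ℝ) * x j : ℝ)) *
      ∏ j, (x j : ℂ) ^ (s j - 1) = ∏ j, (n j : ℂ) ^ (-s j) * Complex.Gamma (s j) := by
  have h1 : ∀ x : Fin r → ℝ, Complex.exp (-(∑ j, (n j : ℝ) * x j : ℝ)) *
      ∏ j, (x j : ℂ) ^ (s j - 1) =
      ∏ j, (fun (j : Fin r) (y : ℝ) => (y : ℂ) ^ (s j - 1) * Complex.exp (-((n j : ℝ) * y))) j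
        (x j) := by
    intro x
    rw [Finset.prod_mul_distrib, ← Complex.exp_sum, mul_comm]
    push_cast
    rw [Finset.sum_neg_distrib]
  simp only [h1]
  rw [restrict_octant]
  refine (integral_fintype_prod_eq_prod
    fun (j : Fin r) (y : ℝ) => (y : ℂ) ^ (s j - 1) * Complex.exp (-((n j : ℝ) * y))).trans ?_
  refine Finset.prod_congr rfl fun j _ => ?_
  rw [Complex.integral_cpow_mul_exp_neg_mul_Ioi (hs j) (by exact_mod_cast hn j)]
  congr 1
  rw [Complex.cpow_neg, one_div, Complex.ofReal_natCast, Complex.inv_cpow]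
  rw [Complex.natCast_arg]
  exact Real.pi_pos.ne

/-- The kernel is expanded in geometric series and integrated termwise; the Gamma integrals turn
`e^{-n_j x_j}` into `n_j ^ (-s_j)`. -/
theorem hasSum_multiPolylogTerm_of_re_pos {r : ℕ} {s z : Fin r → ℂ} (hs : ∀ j, 0 < (s j).re)
    (hz : ∀ j, ‖z j‖ < 1) :
    HasSum (fun m : Fin r → ℕ => multiPolylogTerm s z (tupleOfGaps m))
      ((∏ i, z i) * gammaMellin (polylogKernel z) s) := by
  let F : (Fin r → ℕ) → (Fin r → ℝ) → ℂ := fun m x => (∏ i, z i ^ (m i + 1)) *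
    (Complex.exp (-(∑ j, ((tupleOfGaps m).1 j : ℝ) * x j : ℝ)) * ∏ j, (x j : ℂ) ^ (s j - 1))
  have hexp : ∀ (m : Fin r → ℕ), ∀ x ∈ octant (Fin r),
      ‖Complex.exp (-(∑ j, ((tupleOfGaps m).1 j : ℝ) * x j : ℝ))‖ ≤
        1 * Real.exp (-(∑ j, x j) / 2) := by
    intro m x hx
    rw [Complex.norm_exp, one_mul, Complex.neg_re, Complex.ofReal_re]
    refine Real.exp_le_exp.2 ?_
    have h0 : 0 ≤ ∑ j, x j := Finset.sum_nonneg fun j _ => (hx j).le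
    have h1 : ∑ j, x j ≤ ∑ j, ((tupleOfGaps m).1 j : ℝ) * x j := by
      refine Finset.sum_le_sum fun j _ => le_mul_of_one_le_left (hx j).le ?_
      exact_mod_cast (tupleOfGaps m).2.2 j
    linarith
  have hint : ∀ m, IntegrableOn (fun x : Fin r → ℝ =>
      Complex.exp (-(∑ j, ((tupleOfGaps m).1 j : ℝ) * x j : ℝ)) *
        ∏ j, (x j : ℂ) ^ (s j - 1)) (octant (Fin r)) := fun m =>
    integrableOn_mellin (by fun_prop) (hexp m) hs
  have hF : ∀ m, Integrable (F m) (volume.restrict (octant (Fin r))) := fun m =>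
    (hint m).const_mul _
  have hmaj := (integrableOn_octant_majorant hs hs).const_mul 1
  -- The integral of the norm is at most `∏ |z_i|^{m_i + 1}` times a constant independent of `m`,
  -- because every `n_j ≥ 1`.
  have hsum : Summable fun m => ∫ x in octant (Fin r), ‖F m x‖ := by
    refine Summable.of_nonneg_of_le (fun m => integral_nonneg fun _ => norm_nonneg _) (fun m => ?_)
      (((summable_majorant hz 0)).mul_right (∫ x in octant (Fin r), 1 * ∏ j,
        ((x j) ^ ((s j).re - 1) + (x j) ^ ((s j).re - 1)) * Real.exp (-(x j) / 2)))
    rw [← integral_const_mul]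
    refine setIntegral_mono_on (hF m).norm (hmaj.const_mul _) isOpen_octant.measurableSet
      fun x hx => ?_
    simp only [F]
    rw [norm_mul, norm_prod]
    simp only [pow_zero, one_mul, norm_pow]
    refine mul_le_mul_of_nonneg_left ?_ (Finset.prod_nonneg fun _ _ => by positivity)
    simpa using norm_mellin_integrand_le
      (F := fun x => Complex.exp (-(∑ j, ((tupleOfGaps m).1 j : ℝ) * x j : ℝ)))
      (fun _ => le_rfl) (fun _ => le_rfl) hx (hexp m x hx)
  have h := (hasSum_integral_of_summable_integral_norm hF hsum).mul_left
    (∏ j, 1 / Complex.Gamma (s j))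
  convert! h using 1
  · ext m
    simp only [F]
    rw [integral_const_mul, integral_cpow_mul_exp_neg_sum hs (tupleOfGaps m).2.2,
      multiPolylogTerm_tupleOfGaps, mul_left_comm]
    congr 1
    rw [← Finset.prod_mul_distrib]
    refine Finset.prod_congr rfl fun j _ => ?_
    have := Complex.Gamma_ne_zero_of_re_pos (hs j)
    field_simp
  · rw [gammaMellin, mul_left_comm, ← integral_const_mul (∏ i, z i)]
    congr 1
    refine setIntegral_congr_fun isOpen_octant.measurableSet fun x hx => ?_
    have := (hasSum_polylogKernel hz hx).mul_right (∏ j, (x j : ℂ) ^ (s j - 1))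
    simp only [F, ← mul_assoc]
    exact this.tsum_eq.symm

theorem mem_cutRegion_of_norm_lt_one {r : ℕ} {z : Fin r → ℂ} (hz : ∀ j, ‖z j‖ < 1) :
    z ∈ cutRegion r := by
  intro j x hx h
  have := hz j
  rw [h, Complex.norm_real, Real.norm_eq_abs, abs_of_nonneg (by linarith)] at this
  linarith

/-- Existence of the multiple polylogarithm, with its regularised integral representations. -/
theorem exists_isMultiPolylog (r : ℕ) :
    ∃ G : (Fin r → ℂ) → (Fin r → ℂ) → ℂ, IsMultiPolylog r (fun s z => (∏ i, z i) * G s z) ∧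
      ∀ (l : List (Fin r)) (s : Fin r → ℂ), ∀ z ∈ cutRegion r,
        (∀ j, 0 < ((s + countVec l) j).re) →
        G s z = gammaMellin (iterNegPartial l (polylogKernel z)) (s + countVec l) := by
  obtain ⟨G, hG, hGl⟩ := (smoothDecayFamily_polylogKernel r).exists_continuation (isOpen_cutRegion r)
  refine ⟨G, ⟨?_, fun s z hz => ?_⟩, hGl⟩
  · refine DifferentiableOn.mul (differentiableOn_fun_prod fun i => ?_) hG
    fun_prop
  · have hzc := mem_cutRegion_of_norm_lt_one hz
    have hGs : Differentiable ℂ fun s => G s z := by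
      rw [← differentiableOn_univ]
      exact hG.comp (f := fun s : Fin r → ℂ => (s, z)) (by fun_prop) fun s _ => ⟨mem_univ _, hzc⟩
    -- For fixed `z` in the polydisc both sides are entire in `s`, so the equality for `Re s_j > 0`
    -- extends to all `s`.
    have heq : ∑' m : Fin r → ℕ, multiPolylogTerm s z (tupleOfGaps m) = (∏ i, z i) * G s z := by
      refine eqOn_of_eqOn_re_pos isOpen_univ convex_univ (mem_univ _)
        (f := fun s => ∑' m : Fin r → ℕ, multiPolylogTerm s z (tupleOfGaps m))
        (g := fun s => (∏ i, z i) * G s z)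
        (differentiable_tsum_multiPolylogTerm hz).differentiableOn
        (hGs.const_mul _).differentiableOn (fun s hs => ?_) (mem_univ s)
      have h0 : countVec ([] : List (Fin r)) = 0 := by ext; simp [countVec]
      rw [(hasSum_multiPolylogTerm_of_re_pos hs hz).tsum_eq, hGl [] s z hzc (by simpa [h0] using hs),
        h0, add_zero]
      rfl
    rw [← heq]
    exact (Equiv.ofBijective _ (bijective_tupleOfGaps r)).hasSum_iff.1
      (summable_norm_multiPolylogTerm s hz).of_norm.hasSum

/-! ### Permuting and separating the variables -/

theorem gammaMellin_comp_equiv {ι : Type*} [Fintype ι] (e : ι ≃ ι) (F : (ι → ℝ) → ℂ)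
    (s : ι → ℂ) : gammaMellin F (s ∘ e) = gammaMellin (fun x => F (x ∘ e)) s := by
  let f := MeasurableEquiv.piCongrLeft (fun _ : ι => ℝ) e.symm
  have hf : MeasurePreserving f volume volume :=
    volume_measurePreserving_piCongrLeft (fun _ : ι => ℝ) e.symm
  have hfx : ∀ x, f x = x ∘ e := fun x => by
    ext i
    simpa using MeasurableEquiv.piCongrLeft_apply_apply (β := fun _ : ι => ℝ) e.symm x (e i)
  rw [gammaMellin, gammaMellin, ← hf.setIntegral_preimage_emb f.measurableEmbedding]
  have hpre : f ⁻¹' octant ι = octant ι := by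
    ext x
    simp only [mem_preimage, hfx, octant, mem_ofPred_eq, Function.comp_apply]
    exact ⟨fun h j => by simpa using h (e.symm j), fun h j => h _⟩
  rw [hpre]
  simp only [hfx, Function.comp_apply]
  congr 1
  · exact e.prod_comp fun j => 1 / Complex.Gamma (s j)
  · refine integral_congr_ae (Eventually.of_forall fun x => ?_)
    simp only
    rw [e.prod_comp fun j => (x j : ℂ) ^ (s j - 1)]

/-- Fubini's theorem for the Mellin transform in two groups of variables. -/
theorem gammaMellin_sum_elim {ι κ : Type*} [Fintype ι] [Fintype κ] {K : (ι ⊕ κ → ℝ) → ℂ}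
    {a : ι → ℂ} {b : κ → ℂ}
    (hK : IntegrableOn (fun x => K x * ∏ j, (x j : ℂ) ^ (Sum.elim a b j - 1)) (octant (ι ⊕ κ))) :
    IntegrableOn (fun t => gammaMellin (fun x => K (Sum.elim x t)) a *
      ∏ j, (t j : ℂ) ^ (b j - 1)) (octant κ) ∧
    gammaMellin K (Sum.elim a b) = (∏ j, 1 / Complex.Gamma (b j)) *
      ∫ t in octant κ, gammaMellin (fun x => K (Sum.elim x t)) a *
        ∏ j, (t j : ℂ) ^ (b j - 1) := by
  let e := (MeasurableEquiv.sumPiEquivProdPi fun _ : ι ⊕ κ => ℝ).symm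
  have he : MeasurePreserving e (volume.prod volume) volume :=
    volume_measurePreserving_sumPiEquivProdPi_symm fun _ : ι ⊕ κ => ℝ
  have hex : ∀ p, e p = Sum.elim p.1 p.2 := fun p => by
    ext (i | i) <;> rfl
  have hpre : e ⁻¹' octant (ι ⊕ κ) = octant ι ×ˢ octant κ := by
    ext p
    simp [hex, octant]
  have hint := (he.integrableOn_comp_preimage e.measurableEmbedding).2 hK
  rw [hpre, IntegrableOn, ← Measure.prod_restrict] at hint
  have hker : ∀ p : (ι → ℝ) × (κ → ℝ),
      ((fun x => K x * ∏ j, (x j : ℂ) ^ (Sum.elim a b j - 1)) ∘ e) p =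
      (K (Sum.elim p.1 p.2) * ∏ j, (p.1 j : ℂ) ^ (a j - 1)) * ∏ j, (p.2 j : ℂ) ^ (b j - 1) := by
    intro p
    simp [hex, Fintype.prod_sum_type, mul_assoc]
  have hinner : ∀ t : κ → ℝ, gammaMellin (fun x => K (Sum.elim x t)) a *
      ∏ j, (t j : ℂ) ^ (b j - 1) = (∏ j, 1 / Complex.Gamma (a j)) * ∫ x in octant ι,
        ((fun x => K x * ∏ j, (x j : ℂ) ^ (Sum.elim a b j - 1)) ∘ e) (x, t) := by
    intro t
    simp only [hker]
    rw [integral_mul_const, gammaMellin, mul_assoc]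
  simp only [hinner]
  refine ⟨hint.integral_prod_right.const_mul _, ?_⟩
  rw [integral_const_mul, ← integral_prod_symm _ hint, gammaMellin,
    ← he.setIntegral_preimage_emb e.measurableEmbedding, hpre, ← mul_assoc,
    Fintype.prod_sum_type]
  simp only [Sum.elim_inl, Sum.elim_inr, ← Measure.prod_restrict]
  rw [mul_comm (∏ j, 1 / Complex.Gamma (a j))]
  rfl

/-- Derivatives in the first group of variables commute with freezing the second, so integration by
parts in `x` alone can be carried out inside the inner integral. -/
theorem iterNegPartial_map_inl {ι κ : Type*} [DecidableEq ι] [DecidableEq κ] (l : List ι)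
    (K : (ι ⊕ κ → ℝ) → ℂ) (x : ι → ℝ) (t : κ → ℝ) :
    iterNegPartial (l.map Sum.inl) K (Sum.elim x t) =
      iterNegPartial l (fun x => K (Sum.elim x t)) x := by
  induction l generalizing x with
  | nil => rfl
  | cons j l ih =>
    change negPartial (Sum.inl j) (iterNegPartial (l.map Sum.inl) K) (Sum.elim x t) =
      negPartial j (iterNegPartial l fun x => K (Sum.elim x t)) x
    simp only [negPartial, Sum.update_elim_inl, Sum.elim_inl, ih]

theorem countVec_map_inl {ι κ : Type*} [DecidableEq ι] [DecidableEq κ] (l : List ι) :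
    countVec (l.map (Sum.inl : ι → ι ⊕ κ)) = Sum.elim (countVec l) 0 := by
  ext (j | j)
  · simp [countVec, List.count_map_of_injective _ _ Sum.inl_injective]
  · simp [countVec, List.count_eq_zero]

/-! ### The function `η` and its symmetry -/

theorem etaArg_mem_cutRegion {r : ℕ} (t : Fin r → ℝ) : etaArg t ∈ cutRegion r := by
  intro j x hx h
  rw [etaArg, ← Complex.ofReal_exp, ← Complex.ofReal_one, ← Complex.ofReal_sub] at h
  have := Complex.ofReal_injective h
  linarith [Real.exp_pos (∑ i ∈ Finset.Ici j, t i)]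

theorem etaArg_ne_zero {r : ℕ} {t : Fin r → ℝ} (ht : t ∈ octant (Fin r)) (j : Fin r) :
    etaArg t j ≠ 0 := by
  intro h
  rw [etaArg, ← Complex.ofReal_exp, ← Complex.ofReal_one, ← Complex.ofReal_sub,
    Complex.ofReal_eq_zero] at h
  have : 1 < Real.exp (∑ i ∈ Finset.Ici j, t i) := Real.one_lt_exp_iff.2 (suffixSum_pos ht j)
  linarith

/-- The identity `e^X - (1 - e^T) = e^X + e^T - 1`, which reveals the hidden symmetry of `η`. -/
theorem etaKernel_elim {r : ℕ} (x t : Fin r → ℝ) :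
    etaKernel (Sum.elim x t) = polylogKernel (etaArg t) x := by
  simp only [etaKernel, polylogKernel, etaArg, Sum.elim_comp_inl, Sum.elim_comp_inr, suffixSum]
  refine Finset.prod_congr rfl fun i _ => ?_
  congr 1
  ring

theorem etaKernel_swap {r : ℕ} (x : Fin r ⊕ Fin r → ℝ) :
    etaKernel (x ∘ Sum.swap) = etaKernel x := by
  simp only [etaKernel]
  refine Finset.prod_congr rfl fun i _ => ?_
  rw [add_comm (Complex.exp _)]
  rfl

/-- Existence and symmetry of the continuation of `η`. -/
theorem exists_symmetric_isEtaContinuation (r : ℕ) :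
    IsMultiPolylog r (multiPolylog r) ∧ ∃ η : (Fin r → ℂ) → (Fin r → ℂ) → ℂ,
      IsEtaContinuation r η ∧ ∀ s' s, η s' s = η s s' := by
  obtain ⟨G, hL, hG⟩ := exists_isMultiPolylog r
  have hLi : IsMultiPolylog r (multiPolylog r) := Classical.epsilon_spec ⟨_, hL⟩
  have hη := smoothDecayFamily_etaKernel r
  obtain ⟨H, hHd, hH⟩ := hη.exists_continuation isOpen_univ
  have hHd' : Differentiable ℂ fun s => H s 0 := by
    rw [univ_prod_univ, differentiableOn_univ] at hHd
    exact hHd.comp (f := fun s : Fin r ⊕ Fin r → ℂ => (s, (0 : ℂ))) (by fun_prop)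
  have helim : Differentiable ℂ fun p : (Fin r → ℂ) × (Fin r → ℂ) => Sum.elim p.1 p.2 := by
    rw [differentiable_pi]
    rintro (i | i) <;> simp only [Sum.elim_inl, Sum.elim_inr] <;> fun_prop
  have hsymm : ∀ s, H s 0 = H (s ∘ Sum.swap) 0 := by
    have hpos : ∀ s : Fin r ⊕ Fin r → ℂ, (∀ j, 0 < (s j).re) → H s 0 = gammaMellin etaKernel s := by
      intro s hs
      have h0 : countVec ([] : List (Fin r ⊕ Fin r)) = 0 := by ext; simp [countVec]
      rw [hH [] s 0 (mem_univ _) (by simpa [h0] using hs), h0, add_zero]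
      rfl
    intro s
    refine eqOn_of_eqOn_re_pos isOpen_univ convex_univ (mem_univ _)
      hHd'.differentiableOn (g := fun s => H (s ∘ Sum.swap) 0)
      (hHd'.comp (f := fun s : Fin r ⊕ Fin r → ℂ => s ∘ Sum.swap) ?_).differentiableOn
      (fun s hs => ?_) (mem_univ s)
    · rw [differentiable_pi]
      intro i
      simp only [Function.comp_apply]
      fun_prop
    · rw [hpos s hs, hpos (s ∘ Sum.swap) fun j => hs _]
      have := gammaMellin_comp_equiv (Equiv.sumComm (Fin r) (Fin r)) etaKernel s
      simp only [Equiv.sumComm_apply, etaKernel_swap] at this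
      exact this.symm
  have hmain : ∀ s' s : Fin r → ℂ, (∀ j, 0 < (s j).re) →
      IntegrableOn (etaIntegrand s' s) (posOctant r) ∧
        H (Sum.elim s' s) 0 = etaIntegral s' s := by
    intro s' s hs
    -- As `s'` is arbitrary, each `x`-variable is integrated by parts `N` times until `s' + N` has
    -- positive real parts; the `t`-variables, where `Re s_j > 0`, are left alone.
    obtain ⟨N, hN⟩ := exists_nat_gt (∑ j, |(s' j).re|)
    obtain ⟨l, hl⟩ := exists_list_count_eq (ι := Fin r) N
    have hl' : ∀ j, 0 < ((s' + countVec l) j).re := by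
      intro j
      have h1 := Finset.single_le_sum (f := fun j => |(s' j).re|) (fun _ _ => abs_nonneg _)
        (Finset.mem_univ j)
      have h2 := neg_abs_le (s' j).re
      simp only [Pi.add_apply, Complex.add_re, countVec, hl, Complex.natCast_re]
      linarith
    have hvec : Sum.elim s' s + countVec (l.map (Sum.inl : Fin r → Fin r ⊕ Fin r)) =
        Sum.elim (s' + countVec l) s := by
      rw [countVec_map_inl]
      ext (j | j) <;> simp
    have hpos : ∀ j, 0 < (Sum.elim (s' + countVec l) s j).re := by
      rintro (j | j)
      · exact hl' j
      · exact hs j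
    have heq : ∀ t ∈ octant (Fin r), gammaMellin (fun x => iterNegPartial
        (l.map (Sum.inl : Fin r → Fin r ⊕ Fin r)) etaKernel (Sum.elim x t)) (s' + countVec l) *
        ∏ j, (t j : ℂ) ^ (s j - 1) = etaIntegrand s' s t := by
      intro t ht
      have hprod : ∏ j, etaArg t j ≠ 0 := Finset.prod_ne_zero_iff.2 fun j _ => etaArg_ne_zero ht j
      simp only [iterNegPartial_map_inl, etaKernel_elim]
      -- Uniqueness replaces the chosen `multiPolylog` by the constructed function, whose factor `∏
      -- etaArg t j` cancels the denominator of the integrand.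
      rw [etaIntegrand, hLi.unique hL s' _ (etaArg_mem_cutRegion t),
        mul_div_cancel_left₀ _ hprod, hG l s' _ (etaArg_mem_cutRegion t) hl']
    obtain ⟨h1, h2⟩ := gammaMellin_sum_elim
      ((hη.decay (l.map Sum.inl)).integrableOn (mem_univ (0 : ℂ)) hpos)
    refine ⟨h1.congr_fun heq isOpen_octant.measurableSet, ?_⟩
    rw [hH (l.map Sum.inl) _ 0 (mem_univ _) (by rw [hvec]; exact hpos), hvec, h2, etaIntegral]
    congr 1
    exact setIntegral_congr_fun isOpen_octant.measurableSet heq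
  refine ⟨hLi, fun s' s => H (Sum.elim s' s) 0, ⟨hHd'.comp helim, fun s' s hs => (hmain s' s hs).1,
    fun s' s hs => (hmain s' s hs).2⟩, fun s' s => ?_⟩
  simp only
  rw [hsymm]
  congr 1
  ext (j | j) <;> rfl

/-! ### The Kaneko–Tsumura case `r = 1` -/

theorem etaIntegrand_const (k s : ℂ) (t : ℝ) :
    etaIntegrand (r := 1) (fun _ => k) (fun _ => s) (fun _ => t) = ktIntegrand k s t := by
  have : etaArg (r := 1) (fun _ => t) = fun _ => 1 - Complex.exp (t : ℂ) := by
    ext j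
    have : Finset.Ici j = {j} := by ext i; simp [Subsingleton.elim i j]
    simp [etaArg, this]
  simp [etaIntegrand, ktIntegrand, this]

theorem exists_symmetric_isKanekoTsumuraEta :
    ∃ η : ℂ → ℂ → ℂ, IsKanekoTsumuraEta η ∧ ∀ k l : ℂ, η k l = η l k := by
  obtain ⟨-, η, hη, hsymm⟩ := exists_symmetric_isEtaContinuation 1
  let e := (MeasurableEquiv.funUnique (Fin 1) ℝ).symm
  have he : MeasurePreserving e volume volume :=
    (volume_preserving_funUnique (Fin 1) ℝ).symm _
  have hex : ∀ t, e t = fun _ => t := fun t => rfl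
  have hpre : e ⁻¹' posOctant 1 = Ioi 0 := by
    ext t
    simp [hex, posOctant]
  refine ⟨fun k l => η (fun _ => k) fun _ => l, ⟨?_, fun k s hs => ?_, fun k s hs => ?_⟩,
    fun k l => hsymm _ _⟩
  · exact hη.holo.comp (f := fun p : ℂ × ℂ => ((fun _ : Fin 1 => p.1), fun _ : Fin 1 => p.2))
      (by fun_prop)
  · have := (he.integrableOn_comp_preimage e.measurableEmbedding).2
      (hη.integrable (fun _ => k) (fun _ => s) fun _ => hs)
    rw [hpre] at this
    exact this.congr_fun (fun t _ => etaIntegrand_const k s t) measurableSet_Ioi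
  · rw [hη.eq_integral _ _ fun _ => hs, etaIntegral,
      ← he.setIntegral_preimage_emb e.measurableEmbedding, hpre]
    simp only [hex, etaIntegrand_const, Finset.univ_unique, Finset.prod_singleton]

theorem mainTheorem1 :
    (∀ r : ℕ, 1 ≤ r →
      IsMultiPolylog r (multiPolylog r) ∧
      ∃ η : (Fin r → ℂ) → (Fin r → ℂ) → ℂ,
        IsEtaContinuation r η ∧ ∀ s' s : Fin r → ℂ, η s' s = η s s') ∧
    (∃ η : ℂ → ℂ → ℂ, IsKanekoTsumuraEta η ∧ ∀ k l : ℂ, η k l = η l k) :=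
  ⟨fun r _ => exists_symmetric_isEtaContinuation r, exists_symmetric_isKanekoTsumuraEta⟩
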